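/- Let $R=\bigoplus_{n\ge 0}R_n$ be a standard graded commutative Noetherian ring, that is, $R_0$ is Noetherian and $R$ is generated as an $R_0$-algebra by finitely many elements of $R_1$; put $R_+=\bigoplus_{n\ge 1}R_n$. Assume that $R_0$ is local with maximal ideal $\mathfrak m_0$, and let $J_0\subseteq\mathfrak m_0$ be an ideal of $R_0$. For ideals $I,J$ of $R$ and an $R$-module $M$ put $$\Gamma_{I,J}(M)=\{x\in M : I^n x\subseteq Jx \text{ for all } n\gg 1\}.$$ If $I,J$ are homogeneous and $M$ is a ($\mathbb Z$-)graded $R$-module, then $\Gamma_{I,J}(M)$ is a graded submodule of $M$; let $H^i_{I,J}$ denote the $i$-th right derived functor of $\Gamma_{I,J}$ on the abelian category of graded $R$-modules and homogeneous $R$-homomorphisms (of degree $0$), so that $H^i_{I,J}(M)$ is a graded $R$-module with components $H^i_{I,J}(M)_n$, $n\in\mathbb Z$, which are $R_0$-modules. Then the following statements are equivalent: (a) for every finitely generated graded $R$-module $M$ and every $i\ge 0$ there is $n_0\in\mathbb Z$ such that $H^i_{R_+,J_0R}(M)_n=0$ for all $n\ge n_0$; (b) for every finitely generated graded $R$-module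 $M$, every $i\ge 0$ and every $n\in\mathbb Z$, the $R_0$-module $H^i_{R_+,J_0R}(M)_n$ is finitely generated. -/

import Mathlib

open CategoryTheory CategoryTheory.Limits

universe u

/-- A graded module `M = ⨁_{n ∈ ℤ} M_n` over the `ℕ`-graded commutative ring `R = ⨁_{i ∈ ℕ} R_i`. -/
structure GrMod {R : Type u} [CommRing R] (𝓡 : ℕ → AddSubgroup R) where
  /-- the underlying `R`-module -/
  carrier : Type u
  [addCommGroup : AddCommGroup carrier]
  [module : Module R carrier]
  /-- the homogeneous component of degree `n` -/
  deg : ℤ → AddSubgroup carrier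
  isInternal : DirectSum.IsInternal deg
  smul_mem : ∀ {i : ℕ} {n : ℤ} {r : R} {x : carrier},
    r ∈ 𝓡 i → x ∈ deg n → r • x ∈ deg (i + n)

namespace GrMod

attribute [instance] GrMod.addCommGroup GrMod.module

noncomputable section

section Basic

variable {R : Type u} [CommRing R] {𝓡 : ℕ → AddSubgroup R}

/-- The projection of `M` onto its component of degree `n`, as an endomorphism of `M`. -/
def proj (M : GrMod 𝓡) (n : ℤ) : M.carrier →+ M.carrier :=
  letI := M.isInternal.chooseDecomposition
  ((M.deg n).subtype.comp (DFinsupp.evalAddMonoidHom n)).comp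
    (DirectSum.decomposeAddEquiv M.deg).toAddMonoidHom

variable (M : GrMod 𝓡)

theorem proj_mem (n : ℤ) (x : M.carrier) : M.proj n x ∈ M.deg n := by
  let := M.isInternal.chooseDecomposition
  exact (DirectSum.decompose M.deg x n).2

theorem proj_of_mem {n : ℤ} {x : M.carrier} (hx : x ∈ M.deg n) : M.proj n x = x := by
  let := M.isInternal.chooseDecomposition
  exact DirectSum.decompose_of_mem_same M.deg hx

theorem proj_of_mem_ne {m n : ℤ} {x : M.carrier} (hx : x ∈ M.deg m) (h : m ≠ n) :
    M.proj n x = 0 := by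
  let := M.isInternal.chooseDecomposition
  exact DirectSum.decompose_of_mem_ne M.deg hx h

theorem exists_sum (x : M.carrier) : ∃ s : Finset ℤ, x = ∑ n ∈ s, M.proj n x := by
  classical
  let := M.isInternal.chooseDecomposition
  exact ⟨_, (DirectSum.sum_support_decompose M.deg x).symm⟩

theorem hom_induction {p : M.carrier → Prop} (h0 : p 0) (hadd : ∀ x y, p x → p y → p (x + y))
    (hdeg : ∀ n, ∀ x ∈ M.deg n, p x) (x : M.carrier) : p x := by
  obtain ⟨s, hs⟩ := M.exists_sum x
  rw [hs]
  exact Finset.sum_induction _ p hadd h0 (fun n _ => hdeg n _ (M.proj_mem n x))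

theorem isInternal_of_proj {A : Type*} [AddCommGroup A] (D : ℤ → AddSubgroup A)
    (p : ℤ → A →+ A) (h1 : ∀ n, ∀ x ∈ D n, p n x = x)
    (h2 : ∀ m n, ∀ x ∈ D m, m ≠ n → p n x = 0) (h3 : ∀ x, x ∈ ⨆ n, D n) :
    DirectSum.IsInternal D := by
  classical
  constructor
  · rw [injective_iff_map_eq_zero]
    intro y hy
    have key : ∀ n, ∀ z : DirectSum ℤ (fun n => D n),
        p n (DirectSum.coeAddMonoidHom D z) = z n := by
      intro n z
      induction z using DirectSum.induction_on with
      | zero => simp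
      | of m x =>
        rw [DirectSum.coeAddMonoidHom_of]
        by_cases h : m = n
        · subst h
          rw [DirectSum.of_eq_same]
          exact h1 _ _ x.2
        · rw [DirectSum.of_eq_of_ne _ _ _ (Ne.symm h)]
          exact h2 _ _ _ x.2 h
      | add a b ha hb => simp [ha, hb]
    ext n
    rw [← key n y, hy]
    simp
  · intro x
    have : (⨆ n, D n) ≤ (DirectSum.coeAddMonoidHom D).range :=
      iSup_le fun n x hx => ⟨DirectSum.of (fun n => D n) n ⟨x, hx⟩, by simp⟩
    exact this (h3 x)

/-- The component of degree `n` is a module over `R_0`, by restricting the action of `R`. -/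
instance [SetLike.GradedMonoid 𝓡] (n : ℤ) : Module (𝓡 0) (M.deg n) where
  smul r x := ⟨(r : R) • (x : M.carrier), by simpa using M.smul_mem r.2 x.2⟩
  one_smul x := Subtype.ext (one_smul R (x : M.carrier))
  mul_smul r s x := Subtype.ext (mul_smul (r : R) (s : R) (x : M.carrier))
  smul_zero r := Subtype.ext (smul_zero (r : R))
  smul_add r x y := Subtype.ext (smul_add (r : R) (x : M.carrier) (y : M.carrier))
  add_smul r s x := Subtype.ext (add_smul (r : R) (s : R) (x : M.carrier))
  zero_smul x := Subtype.ext (zero_smul R (x : M.carrier))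

/-- Homogeneous `R`-homomorphisms (of degree `0`). -/
@[ext]
structure Hom (M N : GrMod 𝓡) where
  toLin : M.carrier →ₗ[R] N.carrier
  map_deg : ∀ n, ∀ x ∈ M.deg n, toLin x ∈ N.deg n

/-- The category of graded `R`-modules and homogeneous `R`-homomorphisms. -/
instance : Category (GrMod 𝓡) where
  Hom := Hom
  id M := ⟨LinearMap.id, fun _ _ h => h⟩
  comp f g := ⟨g.toLin.comp f.toLin, fun n x h => g.map_deg n _ (f.map_deg n x h)⟩

/-- The `R`-linear map underlying a morphism. -/
def lin {M N : GrMod 𝓡} (f : M ⟶ N) : M.carrier →ₗ[R] N.carrier := Hom.toLin f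

theorem lin_deg {M N : GrMod 𝓡} (f : M ⟶ N) {n : ℤ} {x : M.carrier} (hx : x ∈ M.deg n) :
    lin f x ∈ N.deg n := Hom.map_deg f n x hx

/-- Make a morphism out of a linear map that preserves degrees. -/
def mkHom {M N : GrMod 𝓡} (f : M.carrier →ₗ[R] N.carrier)
    (h : ∀ n, ∀ x ∈ M.deg n, f x ∈ N.deg n) : M ⟶ N := Hom.mk f h

@[simp] theorem lin_mkHom {M N : GrMod 𝓡} (f : M.carrier →ₗ[R] N.carrier)
    (h : ∀ n, ∀ x ∈ M.deg n, f x ∈ N.deg n) : lin (mkHom f h) = f := rfl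

@[simp] theorem lin_id (M : GrMod 𝓡) : lin (𝟙 M) = LinearMap.id := rfl

@[simp] theorem lin_comp {M N P : GrMod 𝓡} (f : M ⟶ N) (g : N ⟶ P) :
    lin (f ≫ g) = (lin g).comp (lin f) := rfl

theorem hom_ext {M N : GrMod 𝓡} {f g : M ⟶ N} (h : ∀ x, lin f x = lin g x) : f = g :=
  Hom.ext (LinearMap.ext h)

theorem lin_proj {M N : GrMod 𝓡} (f : M ⟶ N) (n : ℤ) (x : M.carrier) :
    lin f (M.proj n x) = N.proj n (lin f x) := by
  induction x using M.hom_induction with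
  | h0 => simp
  | hadd x y hx hy => simp [hx, hy]
  | hdeg m x hx =>
    by_cases h : m = n
    · subst h
      rw [M.proj_of_mem hx, N.proj_of_mem (lin_deg f hx)]
    · rw [M.proj_of_mem_ne hx h, N.proj_of_mem_ne (lin_deg f hx) h, map_zero]

instance (M N : GrMod 𝓡) : Add (M ⟶ N) :=
  ⟨fun f g => mkHom (lin f + lin g) fun _ _ h => add_mem (lin_deg f h) (lin_deg g h)⟩

instance (M N : GrMod 𝓡) : Zero (M ⟶ N) := ⟨mkHom 0 fun _ _ _ => zero_mem _⟩

instance (M N : GrMod 𝓡) : Neg (M ⟶ N) :=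
  ⟨fun f => mkHom (-lin f) fun _ _ h => neg_mem (lin_deg f h)⟩

/-- Morphisms are added and negated pointwise. -/
instance homAddCommGroup (M N : GrMod 𝓡) : AddCommGroup (M ⟶ N) where
  add_assoc f g h := hom_ext fun x => add_assoc (lin f x) (lin g x) (lin h x)
  zero_add f := hom_ext fun x => zero_add (lin f x)
  add_zero f := hom_ext fun x => add_zero (lin f x)
  neg_add_cancel f := hom_ext fun x => neg_add_cancel (lin f x)
  add_comm f g := hom_ext fun x => add_comm (lin f x) (lin g x)
  nsmul := nsmulRec
  zsmul := zsmulRec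

@[simp] theorem lin_add {M N : GrMod 𝓡} (f g : M ⟶ N) : lin (f + g) = lin f + lin g := rfl

@[simp] theorem lin_zero {M N : GrMod 𝓡} : lin (0 : M ⟶ N) = 0 := rfl

instance : Preadditive (GrMod 𝓡) where
  add_comp _ _ _ _ _ h := hom_ext fun _ => map_add (lin h) _ _
  comp_add _ _ _ _ _ _ := hom_ext fun _ => rfl

/-- A homogeneous submodule, as a graded module. -/
def sub (N : Submodule R M.carrier) (hN : ∀ x ∈ N, ∀ n, M.proj n x ∈ N) : GrMod 𝓡 where
  carrier := N
  deg n := (M.deg n).comap N.subtype.toAddMonoidHom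
  isInternal := by
    refine isInternal_of_proj _
      (fun n => ((M.proj n).comp N.subtype.toAddMonoidHom).codRestrict N fun x => hN _ x.2 n)
      (fun n x hx => Subtype.ext (M.proj_of_mem hx))
      (fun m n x hx h => Subtype.ext (M.proj_of_mem_ne hx h)) fun x => ?_
    obtain ⟨s, hs⟩ := M.exists_sum x.1
    have : x = ∑ n ∈ s, (⟨M.proj n x.1, hN _ x.2 n⟩ : N) := Subtype.ext (by simpa using hs)
    rw [this]
    exact sum_mem fun n _ => AddSubgroup.mem_iSup_of_mem n (M.proj_mem n x.1)
  smul_mem hr hx := M.smul_mem hr hx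

/-- The quotient by a homogeneous submodule, as a graded module. -/
def quot (N : Submodule R M.carrier) (hN : ∀ x ∈ N, ∀ n, M.proj n x ∈ N) : GrMod 𝓡 where
  carrier := M.carrier ⧸ N
  deg n := (M.deg n).map N.mkQ.toAddMonoidHom
  isInternal := by
    refine isInternal_of_proj _
      (fun n => QuotientAddGroup.map N.toAddSubgroup N.toAddSubgroup (M.proj n)
        fun x hx => hN x hx n) ?_ ?_ fun x => ?_
    · rintro n _ ⟨x, hx, rfl⟩
      exact congrArg N.mkQ (M.proj_of_mem hx)
    · rintro m n _ ⟨x, hx, rfl⟩ h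
      exact (congrArg N.mkQ (M.proj_of_mem_ne hx h)).trans (map_zero _)
    · obtain ⟨x, rfl⟩ := N.mkQ_surjective x
      induction x using M.hom_induction with
      | h0 => simp
      | hadd x y hx hy => rw [map_add]; exact add_mem hx hy
      | hdeg n x hx => exact AddSubgroup.mem_iSup_of_mem n ⟨x, hx, rfl⟩
  smul_mem := by
    rintro i n r _ hr ⟨x, hx, rfl⟩
    exact ⟨r • x, M.smul_mem hr hx, rfl⟩

/-- The direct sum of two graded modules. -/
def prod (M N : GrMod 𝓡) : GrMod 𝓡 where
  carrier := M.carrier × N.carrier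
  deg n := (M.deg n).prod (N.deg n)
  isInternal := by
    refine isInternal_of_proj _ (fun n => (M.proj n).prodMap (N.proj n))
      (fun n x hx => Prod.ext (M.proj_of_mem hx.1) (N.proj_of_mem hx.2))
      (fun m n x hx h => Prod.ext (M.proj_of_mem_ne hx.1 h) (N.proj_of_mem_ne hx.2 h))
      fun ⟨x, y⟩ => ?_
    have h1 : ((x, 0) : M.carrier × N.carrier) ∈ ⨆ n, (M.deg n).prod (N.deg n) := by
      induction x using M.hom_induction with
      | h0 => exact zero_mem _
      | hadd x y hx hy => simpa using add_mem hx hy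
      | hdeg n x hx => exact AddSubgroup.mem_iSup_of_mem n ⟨hx, zero_mem _⟩
    have h2 : ((0, y) : M.carrier × N.carrier) ∈ ⨆ n, (M.deg n).prod (N.deg n) := by
      induction y using N.hom_induction with
      | h0 => exact zero_mem _
      | hadd x y hx hy => simpa using add_mem hx hy
      | hdeg n x hx => exact AddSubgroup.mem_iSup_of_mem n ⟨zero_mem _, hx⟩
    simpa using add_mem h1 h2
  smul_mem hr hx := ⟨M.smul_mem hr hx.1, N.smul_mem hr hx.2⟩

instance : HasZeroObject (GrMod 𝓡) where
  zero := by
    refine ⟨{ carrier := PUnit, deg := fun _ => ⊥, isInternal := ?_, smul_mem := ?_ }, ?_⟩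
    · exact isInternal_of_proj _ (fun _ => 0) (fun _ _ _ => rfl) (fun _ _ _ _ _ => rfl)
        fun x => zero_mem _
    · exact fun _ _ => rfl
    · rw [IsZero.iff_id_eq_zero]
      exact hom_ext fun x => rfl

instance : HasBinaryBiproducts (GrMod 𝓡) :=
  HasBinaryBiproducts.mk fun {M N} => HasBinaryBiproduct.mk
    { bicone :=
        { pt := prod M N
          fst := mkHom (M := prod M N) (LinearMap.fst R M.carrier N.carrier) fun _ _ h => h.1
          snd := mkHom (M := prod M N) (LinearMap.snd R M.carrier N.carrier) fun _ _ h => h.2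
          inl := mkHom (N := prod M N) (LinearMap.inl R M.carrier N.carrier)
            fun _ _ h => ⟨h, zero_mem _⟩
          inr := mkHom (N := prod M N) (LinearMap.inr R M.carrier N.carrier)
            fun _ _ h => ⟨zero_mem _, h⟩
          inl_fst := rfl
          inl_snd := rfl
          inr_fst := rfl
          inr_snd := rfl }
      isBilimit := isBinaryBilimitOfTotal _ (hom_ext fun x =>
        Prod.ext (add_zero x.1) (zero_add x.2)) }

instance : HasFiniteProducts (GrMod 𝓡) :=
  hasFiniteProducts_of_has_binary_and_terminal

section Kernels

variable {M} {N : GrMod 𝓡} (f : M ⟶ N)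

/-- The kernel of a morphism. -/
def kerObj : GrMod 𝓡 :=
  M.sub (LinearMap.ker (lin f)) fun x hx n => by
    rw [LinearMap.mem_ker] at hx ⊢
    rw [lin_proj, hx, map_zero]

/-- The inclusion of the kernel. -/
def kerι : kerObj f ⟶ M := mkHom (M := kerObj f) (LinearMap.ker (lin f)).subtype fun _ _ h => h

theorem kerι_comp : kerι f ≫ f = 0 := hom_ext fun x => x.2

/-- `kerObj f` is a kernel of `f`. -/
def kerIsLimit : IsLimit (KernelFork.ofι (kerι f) (kerι_comp f)) :=
  KernelFork.IsLimit.ofι _ _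
    (fun g hg => mkHom (N := kerObj f)
      ((lin g).codRestrict (LinearMap.ker (lin f)) fun x => congrArg (fun k => lin k x) hg)
      fun _ _ h => lin_deg g h)
    (fun _ _ => rfl)
    (fun _ _ m hm => hom_ext fun x => Subtype.ext (congrArg (fun k => lin k x) hm))

/-- The cokernel of a morphism. -/
def cokerObj : GrMod 𝓡 :=
  N.quot (LinearMap.range (lin f)) fun x hx n => by
    obtain ⟨y, rfl⟩ := hx
    exact ⟨M.proj n y, lin_proj f n y⟩

/-- The projection to the cokernel. -/
def cokerπ : N ⟶ cokerObj f :=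
  mkHom (N := cokerObj f) (LinearMap.range (lin f)).mkQ fun _ x h => ⟨x, h, rfl⟩

theorem comp_cokerπ : f ≫ cokerπ f = 0 :=
  hom_ext fun x => (Submodule.Quotient.mk_eq_zero _).2 ⟨x, rfl⟩

/-- `cokerObj f` is a cokernel of `f`. -/
def cokerIsColimit : IsColimit (CokernelCofork.ofπ (cokerπ f) (comp_cokerπ f)) :=
  CokernelCofork.IsColimit.ofπ _ _
    (fun g hg => mkHom (M := cokerObj f)
      ((LinearMap.range (lin f)).liftQ (lin g) (by
        rintro _ ⟨x, rfl⟩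
        exact congrArg (fun k => lin k x) hg))
      (by
        rintro n _ ⟨x, hx, rfl⟩
        exact lin_deg g hx))
    (fun _ _ => rfl)
    (fun _ _ _ hm => hom_ext fun x => by
      obtain ⟨x, rfl⟩ := (LinearMap.range (lin f)).mkQ_surjective x
      exact congrArg (fun k => lin k x) hm)

theorem injective_of_mono [Mono f] : Function.Injective (lin f) := by
  have h : kerι f = 0 := by
    rw [← cancel_mono f, kerι_comp, zero_comp]
  rw [injective_iff_map_eq_zero]
  intro x hx
  exact congrArg (fun k => lin k (⟨x, hx⟩ : LinearMap.ker (lin f))) h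

theorem surjective_of_epi [Epi f] : Function.Surjective (lin f) := by
  have h : cokerπ f = 0 := by
    rw [← cancel_epi f, comp_cokerπ, comp_zero]
  intro y
  exact (Submodule.Quotient.mk_eq_zero _).1 (congrArg (fun k => lin k y) h)

theorem mono_of_injective (h : Function.Injective (lin f)) : Mono f :=
  ⟨fun _ _ hg => hom_ext fun x => h (congrArg (fun k => lin k x) hg)⟩

/-- Every monomorphism is the kernel of its cokernel. -/
theorem nonempty_normalMono (hf : Function.Injective (lin f)) : Nonempty (NormalMono f) := ⟨{
  Z := cokerObj f
  g := cokerπ f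
  w := comp_cokerπ f
  isLimit := by
    let e := LinearEquiv.ofInjective (lin f) hf
    have key : ∀ {W : GrMod 𝓡} (g : W ⟶ N), g ≫ cokerπ f = 0 →
        ∀ x, lin g x ∈ LinearMap.range (lin f) := fun g hg x =>
      (Submodule.Quotient.mk_eq_zero _).1 (congrArg (fun k => lin k x) hg)
    have he : ∀ y, lin f (e.symm y) = y := fun y =>
      congrArg Subtype.val (e.apply_symm_apply y)
    refine KernelFork.IsLimit.ofι _ _
      (fun {W} g hg => mkHom (e.symm.toLinearMap.comp
        ((lin g).codRestrict (LinearMap.range (lin f)) (key g hg))) ?_) ?_ ?_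
    · intro n x hx
      have h1 : lin f (e.symm ⟨lin g x, key g hg x⟩) = lin g x := he _
      have h2 : M.proj n (e.symm ⟨lin g x, key g hg x⟩) = e.symm ⟨lin g x, key g hg x⟩ := by
        apply hf
        rw [lin_proj, h1, N.proj_of_mem (lin_deg g hx)]
      change e.symm ⟨lin g x, key g hg x⟩ ∈ M.deg n
      rw [← h2]
      exact M.proj_mem _ _
    · intro W g hg
      exact hom_ext fun x => he _
    · intro W g hg m hm
      refine hom_ext fun x => hf ?_
      exact (congrArg (fun k => lin k x) hm).trans (he ⟨lin g x, key g hg x⟩).symm }⟩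

/-- Every epimorphism is the cokernel of its kernel. -/
theorem nonempty_normalEpi (hf : Function.Surjective (lin f)) : Nonempty (NormalEpi f) := ⟨{
  W := kerObj f
  g := kerι f
  w := kerι_comp f
  isColimit := by
    let e := (lin f).quotKerEquivOfSurjective hf
    have he : ∀ x, e.symm (lin f x) = (LinearMap.ker (lin f)).mkQ x := fun x => by
      rw [LinearEquiv.symm_apply_eq]
      rfl
    have key : ∀ {W : GrMod 𝓡} (g : M ⟶ W), kerι f ≫ g = 0 →
        LinearMap.ker (lin f) ≤ LinearMap.ker (lin g) := fun {W} g hg x hx =>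
      congrArg (fun k : kerObj f ⟶ W => lin k (⟨x, hx⟩ : LinearMap.ker (lin f))) hg
    have he2 : ∀ {W : GrMod 𝓡} (g : M ⟶ W) (hg : kerι f ≫ g = 0) (x : M.carrier),
        ((LinearMap.ker (lin f)).liftQ (lin g) (key g hg)) (e.symm (lin f x)) = lin g x :=
      fun g hg x => by rw [he]; rfl
    refine CokernelCofork.IsColimit.ofπ _ _
      (fun {W} g hg => mkHom (((LinearMap.ker (lin f)).liftQ (lin g) (key g hg)).comp
        e.symm.toLinearMap) ?_) ?_ ?_
    · intro n y hy
      obtain ⟨x, rfl⟩ := hf y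
      have h1 : lin f (M.proj n x) = lin f x := by rw [lin_proj, N.proj_of_mem hy]
      rw [← h1]
      change ((LinearMap.ker (lin f)).liftQ (lin g) (key g hg)) (e.symm _) ∈ _
      rw [he2 g hg]
      exact lin_deg g (M.proj_mem n x)
    · intro W g hg
      exact hom_ext fun x => he2 g hg x
    · intro W g hg m hm
      refine hom_ext fun y => ?_
      obtain ⟨x, rfl⟩ := hf y
      exact (congrArg (fun k => lin k x) hm).trans (he2 g hg x).symm }⟩

end Kernels

/-- Graded modules form an abelian category. -/
instance : Abelian (GrMod 𝓡) where
  normalMonoOfMono f _ := nonempty_normalMono f (injective_of_mono f)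
  normalEpiOfEpi f _ := nonempty_normalEpi f (surjective_of_epi f)
  has_kernels := ⟨fun f => ⟨⟨_, kerIsLimit f⟩⟩⟩
  has_cokernels := ⟨fun f => ⟨⟨_, cokerIsColimit f⟩⟩⟩

section Cofree

variable (N : Type u) [AddCommGroup N] [Module R N]

variable {N} in
/-- The homogeneous homomorphism `x ↦ ∑ n, f (x_n)` to the cofree graded module. -/
def toCofreeFun (f : M.carrier →ₗ[R] N) : M.carrier →+ ℤ →₀ N :=
  letI := M.isInternal.chooseDecomposition
  (DirectSum.toAddMonoid fun n : ℤ =>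
    (Finsupp.singleAddHom n).comp (f.toAddMonoidHom.comp (M.deg n).subtype)).comp
    (DirectSum.decomposeAddEquiv M.deg).toAddMonoidHom

variable {N} in
theorem toCofreeFun_of_mem (f : M.carrier →ₗ[R] N) {n : ℤ} {x : M.carrier} (hx : x ∈ M.deg n) :
    M.toCofreeFun f x = Finsupp.single n (f x) := by
  let := M.isInternal.chooseDecomposition
  have : DirectSum.decomposeAddEquiv M.deg x = DirectSum.of (fun i => M.deg i) n ⟨x, hx⟩ :=
    DirectSum.decompose_of_mem M.deg hx
  change DirectSum.toAddMonoid _ (DirectSum.decomposeAddEquiv M.deg x) = _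
  rw [this, DirectSum.toAddMonoid_of]
  rfl

variable [GradedRing 𝓡]

variable (R) in
/-- Multiplication by `r`, with a shift of degrees by `k`, on finitely supported families
`ℤ →₀ N`. -/
def shift (k : ℕ) : R →+ AddMonoid.End (ℤ →₀ N) where
  toFun r := Finsupp.liftAddHom fun n : ℤ =>
    (Finsupp.singleAddHom ((k : ℤ) + n)).comp (DistribSMul.toAddMonoidHom N r)
  map_zero' := Finsupp.addHom_ext fun n x => by
    refine (Finsupp.liftAddHom_apply_single _ _ _).trans ?_
    exact (congrArg (Finsupp.single _) (zero_smul R x)).trans (Finsupp.single_zero _)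
  map_add' r s := Finsupp.addHom_ext fun n x => by
    refine (Finsupp.liftAddHom_apply_single _ _ _).trans ?_
    refine Eq.trans ?_ (AddMonoidHom.add_apply (M := ℤ →₀ N) (N := ℤ →₀ N) _ _ _).symm
    rw [Finsupp.liftAddHom_apply_single, Finsupp.liftAddHom_apply_single]
    exact (congrArg (Finsupp.single _) (add_smul r s x)).trans (Finsupp.single_add _ _ _)

theorem shift_single (k : ℕ) (r : R) (n : ℤ) (x : N) :
    shift R N k r (Finsupp.single n x) = Finsupp.single ((k : ℤ) + n) (r • x) :=
  Finsupp.liftAddHom_apply_single _ _ _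

variable (𝓡) in
/-- The action of `R` on `ℤ →₀ N` in which `r` of degree `k` sends the copy of `N` in degree `n`
to that in degree `k + n`. -/
def cofreeAction : R →+* AddMonoid.End (ℤ →₀ N) :=
  (DirectSum.toSemiring (A := fun i => 𝓡 i) (fun k => (shift R N k).comp (𝓡 k).subtype)
    (Finsupp.addHom_ext fun n x => by
      change shift R N 0 (1 : R) _ = _
      rw [shift_single, one_smul, Nat.cast_zero, zero_add]
      rfl)
    (fun {i j} a b => Finsupp.addHom_ext fun n x => by
      change shift R N (i + j) ((a : R) * b) _ = shift R N i a (shift R N j b _)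
      rw [shift_single, shift_single, shift_single, mul_smul]
      congr 1
      push_cast
      ring)).comp
    (DirectSum.decomposeRingEquiv 𝓡).toRingHom

theorem cofreeAction_single {k : ℕ} {r : R} (hr : r ∈ 𝓡 k) (n : ℤ) (x : N) :
    cofreeAction 𝓡 N r (Finsupp.single n x) = Finsupp.single ((k : ℤ) + n) (r • x) := by
  have : DirectSum.decomposeRingEquiv 𝓡 r = DirectSum.of (fun i => 𝓡 i) k ⟨r, hr⟩ :=
    DirectSum.decompose_of_mem 𝓡 hr
  have h2 : (DirectSum.decomposeRingEquiv 𝓡).toRingHom r =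
      DirectSum.of (fun i => 𝓡 i) k ⟨r, hr⟩ := this
  rw [cofreeAction, RingHom.comp_apply, h2]
  refine Eq.trans (congrArg (fun g : AddMonoid.End (ℤ →₀ N) => g (Finsupp.single n x))
    (DirectSum.toAddMonoid_of _ _ _)) ?_
  exact shift_single N k r n x

variable (𝓡) in
/-- The type of finitely supported families `ℤ →₀ N`, with the action `cofreeAction`. -/
def CofreeCarrier (_ : ℕ → AddSubgroup R) (N : Type u) [AddCommGroup N] : Type u := ℤ →₀ N

instance : AddCommGroup (CofreeCarrier 𝓡 N) := inferInstanceAs (AddCommGroup (ℤ →₀ N))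

instance : Module R (CofreeCarrier 𝓡 N) :=
  Module.compHom (ℤ →₀ N) (cofreeAction 𝓡 N)

variable (𝓡) in
/-- The graded module `⨁_{n ∈ ℤ} N`, with a copy of `N` in each degree. -/
def cofree : GrMod 𝓡 where
  carrier := CofreeCarrier 𝓡 N
  deg n := (Finsupp.singleAddHom n : N →+ ℤ →₀ N).range
  isInternal := by
    refine isInternal_of_proj (A := ℤ →₀ N) _
      (fun n => (Finsupp.singleAddHom n).comp (Finsupp.applyAddHom n)) ?_ ?_ ?_
    · rintro n _ ⟨x, rfl⟩
      simp
    · rintro m n _ ⟨x, rfl⟩ h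
      simp [Finsupp.single_eq_of_ne (Ne.symm h)]
    · intro x
      induction x using Finsupp.induction_linear with
      | zero => exact zero_mem _
      | add x y hx hy => exact add_mem hx hy
      | single n x => exact AddSubgroup.mem_iSup_of_mem n ⟨x, rfl⟩
  smul_mem := by
    rintro i n r _ hr ⟨x, rfl⟩
    exact ⟨r • x, (cofreeAction_single N hr n x).symm⟩

/-- The sum of the entries of a family. -/
def sumHom : (ℤ →₀ N) →+ N := Finsupp.liftAddHom fun _ : ℤ => AddMonoidHom.id N

theorem sumHom_single (n : ℤ) (x : N) : sumHom N (Finsupp.single n x) = x :=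
  Finsupp.liftAddHom_apply_single _ _ _

theorem sumHom_cofreeAction (r : R) (x : ℤ →₀ N) :
    sumHom N (cofreeAction 𝓡 N r x) = r • sumHom N x := by
  induction r using DirectSum.Decomposition.inductionOn 𝓡 with
  | zero => rw [map_zero, zero_smul]; exact map_zero _
  | add r s hr hs =>
    rw [map_add, add_smul, ← hr, ← hs]
    exact map_add _ _ _
  | homogeneous r =>
    induction x using Finsupp.induction_linear with
    | zero => simp
    | add x y hx hy => rw [map_add, map_add, hx, hy, map_add, smul_add]
    | single n x => rw [cofreeAction_single N r.2, sumHom_single, sumHom_single]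

variable (𝓡) in
/-- The sum of the entries of a family, as an `R`-linear map. -/
def cofreeSum : (cofree 𝓡 N).carrier →ₗ[R] N where
  toFun := sumHom N
  map_add' := map_add (sumHom N)
  map_smul' := sumHom_cofreeAction (𝓡 := 𝓡) N

variable {N} in
theorem toCofreeFun_smul (f : M.carrier →ₗ[R] N) (r : R) (x : M.carrier) :
    M.toCofreeFun f (r • x) = cofreeAction 𝓡 N r (M.toCofreeFun f x) := by
  induction r using DirectSum.Decomposition.inductionOn 𝓡 with
  | zero => rw [map_zero, zero_smul, map_zero]; rfl
  | add r s hr hs =>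
    rw [map_add, add_smul, map_add, hr, hs]
    rfl
  | homogeneous r =>
    induction x using M.hom_induction with
    | h0 => simp
    | hadd x y hx hy => rw [smul_add, map_add, map_add, hx, hy, map_add]
    | hdeg n x hx =>
      rw [M.toCofreeFun_of_mem f hx, M.toCofreeFun_of_mem f (M.smul_mem r.2 hx),
        cofreeAction_single N r.2, map_smul]

variable {M N} in
/-- `R`-linear maps `M → N` induce morphisms from `M` to the cofree graded module on `N`. -/
def toCofree (f : M.carrier →ₗ[R] N) : M ⟶ cofree 𝓡 N :=
  mkHom (N := cofree 𝓡 N)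
    { toFun := M.toCofreeFun f
      map_add' := map_add (M.toCofreeFun f)
      map_smul' := M.toCofreeFun_smul f }
    fun _ x hx => ⟨f x, (M.toCofreeFun_of_mem f hx).symm⟩

variable {N} in
theorem cofreeSum_toCofree (f : M.carrier →ₗ[R] N) (x : M.carrier) :
    cofreeSum 𝓡 N (lin (toCofree f) x) = f x := by
  induction x using M.hom_induction with
  | h0 => simp
  | hadd x y hx hy => simp [hx, hy]
  | hdeg n x hx =>
    exact (congrArg (sumHom N) (M.toCofreeFun_of_mem f hx)).trans (sumHom_single N n _)

variable {M N} in
theorem toCofree_cofreeSum (g : M ⟶ cofree 𝓡 N) :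
    toCofree ((cofreeSum 𝓡 N).comp (lin g)) = g := by
  refine hom_ext fun x => ?_
  induction x using M.hom_induction with
  | h0 => simp
  | hadd x y hx hy => rw [map_add, map_add, hx, hy]
  | hdeg n x hx =>
    refine (M.toCofreeFun_of_mem _ hx).trans ?_
    obtain ⟨y, hy⟩ := lin_deg g hx
    have h : cofreeSum 𝓡 N (lin g x) = y :=
      (congrArg (sumHom N) hy.symm).trans (sumHom_single N n y)
    change Finsupp.single n (cofreeSum 𝓡 N (lin g x)) = _
    rw [h]
    exact hy

end Cofree

section EnoughInjectives

variable (𝓡) in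
/-- The functor that forgets the grading. -/
def forgetGrading : GrMod 𝓡 ⥤ ModuleCat.{u} R where
  obj M := ModuleCat.of R M.carrier
  map f := ModuleCat.ofHom (lin f)

variable [GradedRing 𝓡]

theorem toCofree_comp {M : GrMod 𝓡} {N P : Type u} [AddCommGroup N] [Module R N]
    [AddCommGroup P] [Module R P] (f : M.carrier →ₗ[R] N) (g : N →ₗ[R] P) :
    toCofree f ≫ toCofree (g.comp (cofreeSum 𝓡 N)) = toCofree (𝓡 := 𝓡) (g.comp f) := by
  rw [← toCofree_cofreeSum (toCofree f ≫ toCofree (g.comp (cofreeSum 𝓡 N)))]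
  refine congrArg toCofree (LinearMap.ext fun x => ?_)
  refine (cofreeSum_toCofree _ (g.comp (cofreeSum 𝓡 N)) _).trans ?_
  exact congrArg g (cofreeSum_toCofree _ f x)

variable (𝓡) in
/-- The cofree graded module, as a functor. -/
def cofreeFunctor : ModuleCat.{u} R ⥤ GrMod 𝓡 where
  obj N := cofree 𝓡 N
  map {N _} f := toCofree (f.hom.comp (cofreeSum 𝓡 N))
  map_id N := toCofree_cofreeSum (𝟙 (cofree 𝓡 N))
  map_comp {N _ _} f g :=
    (toCofree_comp (f.hom.comp (cofreeSum 𝓡 N)) g.hom).symm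

variable (𝓡) in
/-- Forgetting the grading is left adjoint to the cofree graded module. -/
def forgetAdjunction : forgetGrading 𝓡 ⊣ cofreeFunctor 𝓡 :=
  Adjunction.mkOfHomEquiv
    { homEquiv := fun M N =>
        { toFun := fun f => toCofree f.hom
          invFun := fun g => ModuleCat.ofHom ((cofreeSum 𝓡 N).comp (lin g))
          left_inv := fun f => ModuleCat.hom_ext (LinearMap.ext (M.cofreeSum_toCofree f.hom))
          right_inv := fun g => toCofree_cofreeSum g }
      homEquiv_naturality_left_symm := fun _ _ => rfl
      homEquiv_naturality_right := fun {M _ _} f g =>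
        (toCofree_comp (M := M) f.hom g.hom).symm }

instance : (forgetGrading 𝓡).PreservesMonomorphisms where
  preserves f _ := (ModuleCat.mono_iff_injective _).2 (injective_of_mono f)

instance : (forgetGrading 𝓡).ReflectsMonomorphisms where
  reflects f _ := mono_of_injective f ((ModuleCat.mono_iff_injective _).1 ‹_›)

/-- The category of graded modules has enough injectives. -/
instance : EnoughInjectives (GrMod 𝓡) :=
  EnoughInjectives.of_adjunction (forgetAdjunction 𝓡)

end EnoughInjectives

section Torsion

theorem proj_smul {k : ℕ} {r : R} (hr : r ∈ 𝓡 k) (n : ℤ) (x : M.carrier) :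
    M.proj n (r • x) = r • M.proj (n - k) x := by
  induction x using M.hom_induction with
  | h0 => simp
  | hadd x y hx hy => rw [smul_add, map_add, map_add, hx, hy, smul_add]
  | hdeg m x hx =>
    by_cases h : (k : ℤ) + m = n
    · subst h
      rw [M.proj_of_mem (M.smul_mem hr hx), add_sub_cancel_left, M.proj_of_mem hx]
    · rw [M.proj_of_mem_ne (M.smul_mem hr hx) h, M.proj_of_mem_ne hx (by omega), smul_zero]

/-- The elements that have a power that kills all components of `x`. -/
def radAnn (x : M.carrier) : Ideal R :=
  ⨅ n : ℤ, (Ideal.torsionOf R M.carrier (M.proj n x)).radical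

theorem mem_radAnn {x : M.carrier} {y : R} :
    y ∈ M.radAnn x ↔ ∀ n, ∃ k : ℕ, y ^ k • M.proj n x = 0 := by
  simp [radAnn, Submodule.mem_iInf, Ideal.mem_radical_iff, Ideal.mem_torsionOf_iff]

theorem radAnn_le (x : M.carrier) : M.radAnn x ≤ (Ideal.torsionOf R M.carrier x).radical := by
  classical
  intro y hy
  rw [mem_radAnn] at hy
  choose K hK using hy
  obtain ⟨s, hs⟩ := M.exists_sum x
  refine ⟨∑ n ∈ s, K n, ?_⟩
  rw [Ideal.mem_torsionOf_iff, hs, Finset.smul_sum]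
  refine Finset.sum_eq_zero fun n hn => ?_
  have hle : K n ≤ ∑ n ∈ s, K n := Finset.single_le_sum (fun _ _ => Nat.zero_le _) hn
  rw [← Nat.sub_add_cancel hle, pow_add, mul_smul, hK n, smul_zero]

variable [GradedRing 𝓡]

/-- If `z` kills `x`, then each component of `x` is killed by a power of the lowest component
of `z`. -/
theorem lowest_pow_smul {z : R} {x : M.carrier} (hzx : z • x = 0) (l : ℕ)
    (hl : ∀ k < l, GradedRing.proj 𝓡 k z = 0) (n : ℤ) :
    ∃ K : ℕ, GradedRing.proj 𝓡 l z ^ K • M.proj n x = 0 := by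
  classical
  obtain ⟨t, ht⟩ := M.exists_sum x
  obtain ⟨B, hB⟩ : ∃ B : ℤ, ∀ n < B, M.proj n x = 0 := by
    obtain ⟨B, hB⟩ := t.finite_toSet.bddBelow
    refine ⟨B, fun n hn => ?_⟩
    rw [ht, map_sum]
    refine Finset.sum_eq_zero fun m hm => M.proj_of_mem_ne (M.proj_mem m x) ?_
    have := hB hm
    omega
  have key : ∀ d : ℕ, ∀ n : ℤ, n < B + d →
      ∃ K : ℕ, GradedRing.proj 𝓡 l z ^ K • M.proj n x = 0 := by
    intro d
    induction d with
    | zero => exact fun n hn => ⟨0, by rw [hB n (by simpa using hn), smul_zero]⟩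
    | succ d ih =>
      intro n hn
      set y := GradedRing.proj 𝓡 l z with hy
      have hz : ∑ k ∈ (DirectSum.decompose 𝓡 z).support, GradedRing.proj 𝓡 k z = z :=
        DirectSum.sum_support_decompose 𝓡 z
      set s := (DirectSum.decompose 𝓡 z).support
      have hs : ∀ k, k ∉ s → GradedRing.proj 𝓡 k z = 0 := fun k hk => by
        simpa [s, GradedRing.proj_apply] using hk
      have hmem : ∀ k, GradedRing.proj 𝓡 k z ∈ 𝓡 k := fun k => by
        rw [GradedRing.proj_apply]; exact SetLike.coe_mem _
      have h0 : ∑ k ∈ s, GradedRing.proj 𝓡 k z • M.proj (l + n - k) x = 0 := by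
        have : M.proj (l + n) (z • x) = 0 := by rw [hzx, map_zero]
        rw [← hz, Finset.sum_smul, map_sum] at this
        rw [← this]
        exact Finset.sum_congr rfl fun k _ => (M.proj_smul (hmem k) _ _).symm
      have hK : ∀ k : ℕ, ∃ K : ℕ, k ≠ l →
          y ^ K • (GradedRing.proj 𝓡 k z • M.proj (l + n - k) x) = 0 := by
        intro k
        rcases lt_trichotomy k l with h | h | h
        · exact ⟨0, fun _ => by rw [hl k h, zero_smul, smul_zero]⟩
        · exact ⟨0, fun h' => absurd h h'⟩
        · obtain ⟨K, hK⟩ := ih (l + n - k) (by omega)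
          exact ⟨K, fun _ => by rw [smul_comm, hK, smul_zero]⟩
      choose K hK using hK
      refine ⟨(∑ k ∈ s, K k) + 1, ?_⟩
      by_cases hls : l ∈ s
      · have h1 := congrArg (fun w => y ^ (∑ k ∈ s, K k) • w) h0
        rw [smul_zero, Finset.smul_sum] at h1
        rw [Finset.sum_eq_single_of_mem l hls] at h1
        · rw [add_sub_cancel_left, ← hy] at h1
          rw [pow_succ, mul_smul]
          exact h1
        · intro k hk hkl
          have hle : K k ≤ ∑ k ∈ s, K k := Finset.single_le_sum (fun _ _ => Nat.zero_le _) hk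
          rw [← Nat.sub_add_cancel hle, pow_add, mul_smul, hK k hkl, smul_zero]
      · rw [hy, hs l hls, pow_succ, mul_zero, zero_smul]
  exact key (n - B + 1).toNat n (by omega)

theorem pow_lowest (y : R) (l : ℕ) (hl : ∀ k < l, GradedRing.proj 𝓡 k y = 0) (s : ℕ) :
    (∀ k < s * l, GradedRing.proj 𝓡 k (y ^ s) = 0) ∧
      GradedRing.proj 𝓡 (s * l) (y ^ s) = GradedRing.proj 𝓡 l y ^ s := by
  classical
  have mul_low : ∀ (a b : R) (i j : ℕ), (∀ k < i, GradedRing.proj 𝓡 k a = 0) →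
      (∀ k < j, GradedRing.proj 𝓡 k b = 0) → (∀ k < i + j, GradedRing.proj 𝓡 k (a * b) = 0) ∧
      GradedRing.proj 𝓡 (i + j) (a * b) = GradedRing.proj 𝓡 i a * GradedRing.proj 𝓡 j b := by
    intro a b i j ha hb
    have hmul : ∀ k, GradedRing.proj 𝓡 k (a * b) =
        ∑ p ∈ Finset.HasAntidiagonal.antidiagonal k, GradedRing.proj 𝓡 p.1 a * GradedRing.proj 𝓡 p.2 b := by
      intro k
      simp only [GradedRing.proj_apply, DirectSum.decompose_mul]
      exact DirectSum.coe_mul_apply_eq_sum_antidiagonal _ _ _ _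
    constructor
    · intro k hk
      rw [hmul]
      refine Finset.sum_eq_zero fun p hp => ?_
      rw [Finset.HasAntidiagonal.mem_antidiagonal] at hp
      by_cases h : p.1 < i
      · rw [ha _ h, zero_mul]
      · rw [hb p.2 (by omega), mul_zero]
    · rw [hmul, Finset.sum_eq_single_of_mem (i, j) (by simp)]
      intro p hp hne
      rw [Finset.HasAntidiagonal.mem_antidiagonal] at hp
      by_cases h : p.1 < i
      · rw [ha _ h, zero_mul]
      · rw [hb p.2, mul_zero]
        by_contra h'
        exact hne (Prod.ext (by simp only; omega) (by simp only; omega))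
  induction s with
  | zero =>
    refine ⟨fun k hk => by omega, ?_⟩
    rw [zero_mul, pow_zero, pow_zero, GradedRing.proj_apply]
    exact DirectSum.decompose_of_mem_same 𝓡 SetLike.GradedOne.one_mem
  | succ s ih =>
    have := mul_low (y ^ s) y (s * l) l ih.1 hl
    rw [ih.2, ← Nat.succ_mul, ← pow_succ, ← pow_succ] at this
    exact this

/-- An element with a power that kills `x` has a power that kills all components of `x`. -/
theorem torsionOf_radical_le (x : M.carrier) :
    (Ideal.torsionOf R M.carrier x).radical ≤ M.radAnn x := by
  classical
  intro y
  induction hc : (DirectSum.decompose 𝓡 y).support.card using Nat.strong_induction_on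
    generalizing y with
  | _ c ih =>
    intro hy
    by_cases hs : (DirectSum.decompose 𝓡 y).support.Nonempty
    · set l := (DirectSum.decompose 𝓡 y).support.min' hs with hl_def
      have hlmem := Finset.min'_mem _ hs
      rw [← hl_def] at hlmem
      have hl : ∀ k < l, GradedRing.proj 𝓡 k y = 0 := by
        intro k hk
        by_contra h
        have : k ∈ (DirectSum.decompose 𝓡 y).support := by
          simpa [GradedRing.proj_apply] using h
        exact absurd (Finset.min'_le _ k this) (by omega)
      obtain ⟨s, hsx⟩ := hy
      rw [Ideal.mem_torsionOf_iff] at hsx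
      have hlow := pow_lowest (𝓡 := 𝓡) y l hl s
      have h1 : GradedRing.proj 𝓡 l y ∈ M.radAnn x := by
        rw [mem_radAnn]
        intro n
        obtain ⟨K, hK⟩ := M.lowest_pow_smul hsx (s * l) hlow.1 n
        exact ⟨s * K, by rwa [hlow.2, ← pow_mul] at hK⟩
      have h2 : y - GradedRing.proj 𝓡 l y ∈ (Ideal.torsionOf R M.carrier x).radical :=
        sub_mem ⟨s, (Ideal.mem_torsionOf_iff _ _).2 hsx⟩ (M.radAnn_le x h1)
      have h3 : (DirectSum.decompose 𝓡 (y - GradedRing.proj 𝓡 l y)).support.card < c := by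
        rw [← hc]
        have hP : ∀ k, GradedRing.proj 𝓡 k (y - GradedRing.proj 𝓡 l y) =
            if k = l then 0 else GradedRing.proj 𝓡 k y := by
          intro k
          have hm : GradedRing.proj 𝓡 l y ∈ 𝓡 l := by
            rw [GradedRing.proj_apply]; exact SetLike.coe_mem _
          rw [map_sub, GradedRing.proj_apply 𝓡 k (GradedRing.proj 𝓡 l y)]
          split_ifs with h
          · rw [h, DirectSum.decompose_of_mem_same 𝓡 hm, sub_self]
          · rw [DirectSum.decompose_of_mem_ne 𝓡 hm (Ne.symm h), sub_zero]
        have hsupp : ∀ (k : ℕ) (w : R), k ∈ (DirectSum.decompose 𝓡 w).support ↔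
            GradedRing.proj 𝓡 k w ≠ 0 := fun k w => by
          simp [GradedRing.proj_apply]
        refine Finset.card_lt_card ⟨fun k hk => ?_, fun hsub => ?_⟩
        · rw [hsupp, hP] at hk
          rw [hsupp]
          split_ifs at hk with h
          · exact absurd rfl hk
          · exact hk
        · have := hsub hlmem
          rw [hsupp, hP, if_pos rfl] at this
          exact this rfl
      have := add_mem (ih _ h3 rfl h2) h1
      rwa [sub_add_cancel] at this
    · have : y = 0 := by
        rw [Finset.not_nonempty_iff_eq_empty, DFinsupp.support_eq_empty] at hs
        exact (DirectSum.decomposeAddEquiv 𝓡).map_eq_zero_iff.1 hs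
      rw [this]
      exact zero_mem _

/-- `Γ_{I,J}(M) = {x ∈ M | I ^ n x ⊆ J x for n ≫ 1}`. Since `I ^ n x` decreases with `n`, it is
enough that one `n` has this property. -/
def pairTorsion (I J : Ideal R) (M : Type*) [AddCommGroup M] [Module R M] : Submodule R M where
  carrier := {x | ∃ n : ℕ, ∀ a ∈ I ^ n, ∃ b ∈ J, a • x = b • x}
  zero_mem' := ⟨0, fun _ _ => ⟨0, zero_mem _, by simp⟩⟩
  smul_mem' := by
    rintro r x ⟨n, hn⟩
    refine ⟨n, fun a ha => ?_⟩
    obtain ⟨b, hb, h⟩ := hn a ha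
    exact ⟨b, hb, by rw [smul_comm, h, smul_comm]⟩
  add_mem' := by
    rintro x y ⟨n, hn⟩ ⟨m, hm⟩
    refine ⟨n + m, fun a ha => ?_⟩
    rw [pow_add] at ha
    induction ha using Submodule.mul_induction_on' with
    | mem_mul_mem c hc d hd =>
      obtain ⟨b, hb, h⟩ := hn c hc
      obtain ⟨e, he, h'⟩ := hm d hd
      have h1 : (c - b) • x = 0 := by rw [sub_smul, h, sub_self]
      have h2 : (d - e) • y = 0 := by rw [sub_smul, h', sub_self]
      refine ⟨c * d - (c - b) * (d - e), ?_, ?_⟩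
      · have : c * d - (c - b) * (d - e) = c * e + b * (d - e) := by ring
        rw [this]
        exact add_mem (J.mul_mem_left _ he) (J.mul_mem_right _ hb)
      · rw [sub_smul (c * d), smul_add ((c - b) * (d - e)), mul_smul _ _ y, h2,
          mul_comm (c - b), mul_smul _ _ x, h1]
        simp
    | add a _ a' _ h h' =>
      obtain ⟨b, hb, h⟩ := h
      obtain ⟨b', hb', h'⟩ := h'
      exact ⟨b + b', add_mem hb hb', by rw [add_smul, h, h', add_smul]⟩

theorem mem_pairTorsion_iff {I J : Ideal R} {M : Type*} [AddCommGroup M] [Module R M] {x : M} :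
    x ∈ pairTorsion I J M ↔ ∃ n : ℕ, I ^ n ≤ Ideal.torsionOf R M x ⊔ J := by
  refine exists_congr fun n => forall₂_congr fun a _ => ?_
  rw [Submodule.mem_sup]
  constructor
  · rintro ⟨b, hb, h⟩
    exact ⟨a - b, (Ideal.mem_torsionOf_iff _ _).2 (by rw [sub_smul, h, sub_self]), b, hb, by ring⟩
  · rintro ⟨c, hc, b, hb, rfl⟩
    exact ⟨b, hb, by rw [add_smul, (Ideal.mem_torsionOf_iff _ _).1 hc, zero_add]⟩

/-- Over a Noetherian ring, `Γ_{I,J}(M)` is a homogeneous submodule of `M`. -/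
theorem proj_mem_pairTorsion [IsNoetherianRing R] (I J : Ideal R) {x : M.carrier}
    (hx : x ∈ pairTorsion I J M.carrier) (n : ℤ) : M.proj n x ∈ pairTorsion I J M.carrier := by
  rw [mem_pairTorsion_iff] at hx ⊢
  obtain ⟨k, hk⟩ := hx
  set K := Ideal.torsionOf R M.carrier (M.proj n x) ⊔ J with hK
  have h1 : Ideal.torsionOf R M.carrier x ≤ K.radical :=
    Ideal.le_radical.trans <| (M.torsionOf_radical_le x).trans <| (iInf_le _ n).trans <|
      Ideal.radical_mono le_sup_left
  have h2 : I ^ k ≤ K.radical := hk.trans (sup_le h1 (le_sup_right.trans Ideal.le_radical))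
  obtain ⟨t, ht⟩ := K.exists_radical_pow_le_of_fg (IsNoetherian.noetherian _)
  exact ⟨k * t, by rw [pow_mul]; exact (Ideal.pow_right_mono h2 t).trans ht⟩

end Torsion

section LocalCohomology

variable (𝓡) [GradedRing 𝓡] [IsNoetherianRing R] (I J : Ideal R)

/-- The `(I, J)`-torsion functor `Γ_{I,J}` on graded modules. -/
def gamma : GrMod 𝓡 ⥤ GrMod 𝓡 where
  obj M := M.sub (pairTorsion I J M.carrier) fun _ hx n => M.proj_mem_pairTorsion I J hx n
  map {M N} f :=
    { toLin := (lin f).restrict (p := pairTorsion I J M.carrier) (q := pairTorsion I J N.carrier)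
        (by
          rintro x ⟨n, hn⟩
          refine ⟨n, fun a ha => ?_⟩
          obtain ⟨b, hb, h⟩ := hn a ha
          exact ⟨b, hb, by rw [← map_smul, h, map_smul]⟩)
      map_deg := fun _ _ hx => lin_deg f hx }

instance : (gamma 𝓡 I J).Additive where
  map_add := rfl

/-- The graded local cohomology functor `H^i_{I,J}` with respect to the pair of ideals `(I, J)`:
the `i`-th right derived functor of `Γ_{I,J}` on the category of graded modules. -/
def pairLocalCohomology (i : ℕ) : GrMod 𝓡 ⥤ GrMod 𝓡 :=
  (gamma 𝓡 I J).rightDerived i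

end LocalCohomology

end Basic
end
end GrMod

/-! The equivalence holds because both statements are true. The ideal J₀R plays no role in the
torsion: if x is homogeneous and R_+^k ⊆ Ann(x) + J₀R, then comparing components of degree k gives
R_k ⊆ Ann(x) + J₀R_k. As R_k is finitely generated over the local ring R₀ and J₀ ⊆ 𝔪₀, Nakayama's
lemma yields R_k ⊆ Ann(x), hence R_+^k x = 0. So Γ_{R_+,J₀R} = Γ_{R_+} (`GrMod.pairTorsion_eq`), and
what remains is Serre's finiteness theorem for graded local cohomology
(`GrMod.isTame_pairLocalCohomology`): the components of H^i(M) are finitely generated over R₀ and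
vanish in large degrees.

That theorem is proved by induction on the number of generators of R_+ that need not kill M. If all
of them kill M, then H^0(M) embeds in M, whose components are finitely generated and vanish in large
degrees. The higher H^i(M) vanish because torsion modules have resolutions by torsion injectives.
This rests on the fact that Γ_{R_+} preserves injectives (`GrMod.injective_gamma_obj`), which comes
from Artin–Rees.

Otherwise take a generator x and the map x : M → M(1). Its kernel and cokernel are killed by x, so
induction applies to them. The long exact sequences then show that x : H^i(M)_n → H^i(M)_{n+1} is
injective for large n, and that H^i(M)_n is finitely generated whenever H^i(M)_{n+1} is. Since each
element of H^i(M) is killed by a power of x, injectivity forces vanishing in large degrees, and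
finiteness follows by descending from there (`GrMod.isTame_of_kernel_of_cokernel`). -/

noncomputable section Horseshoe

/-! ### Horseshoe lemma and long exact sequence of right derived functors -/

namespace CategoryTheory

variable {C : Type*} [Category* C] [Abelian C]

/-- The complex `K` shifted by one to the left and truncated, with the sign of the differential
changed. -/
def truncShift (K : CochainComplex C ℕ) : CochainComplex C ℕ where
  X n := K.X (n + 1)
  -- The sign turns the anticommutation θd + dθ = 0 required of a twist into the condition for a
  -- chain map into this complex.
  d i j := -K.d (i + 1) (j + 1)
  shape i j h := by
    rw [K.shape, neg_zero]
    simpa using h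
  d_comp_d' := by simp

section

variable {P₀ P₁ P₂ Q₀ Q₁ Q₂ : C}

/-- The upper triangular morphism with diagonal entries `p`, `q` and upper entry `t`. -/
def biprodUpper (p : P₀ ⟶ P₁) (t : Q₀ ⟶ P₁) (q : Q₀ ⟶ Q₁) : P₀ ⊞ Q₀ ⟶ P₁ ⊞ Q₁ :=
  biprod.desc (biprod.lift p 0) (biprod.lift t q)

/-- The only off-diagonal entry of the product of the triangular matrices is `t ≫ p' + q ≫ t'`, so
`ht` is what makes a twisted differential square to zero. -/
theorem biprodUpper_comp {p : P₀ ⟶ P₁} {t : Q₀ ⟶ P₁} {q : Q₀ ⟶ Q₁} {p' : P₁ ⟶ P₂} {t' : Q₁ ⟶ P₂}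
    {q' : Q₁ ⟶ Q₂} (hp : p ≫ p' = 0) (hq : q ≫ q' = 0) (ht : t ≫ p' + q ≫ t' = 0) :
    biprodUpper p t q ≫ biprodUpper p' t' q' = 0 := by
  refine biprod.hom_ext' _ _ (biprod.hom_ext _ _ ?_ ?_) (biprod.hom_ext _ _ ?_ ?_) <;>
    simp [biprodUpper, biprod.lift_desc, hp, hq, ht]

theorem inl_biprodUpper (p : P₀ ⟶ P₁) (t : Q₀ ⟶ P₁) (q : Q₀ ⟶ Q₁) :
    biprod.inl ≫ biprodUpper p t q = p ≫ biprod.inl :=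
  biprod.hom_ext _ _ (by simp [biprodUpper]) (by simp [biprodUpper])

theorem biprodUpper_snd (p : P₀ ⟶ P₁) (t : Q₀ ⟶ P₁) (q : Q₀ ⟶ Q₁) :
    biprodUpper p t q ≫ biprod.snd = biprod.snd ≫ q :=
  biprod.hom_ext' _ _ (by simp [biprodUpper]) (by simp [biprodUpper])

/-- The beginning of the long exact sequence of a twisted sum. -/
theorem exact_and_mono_lift_biprodUpper {S : ShortComplex C} (hS : S.ShortExact)
    {i : S.X₁ ⟶ P₀} {p : P₀ ⟶ P₁} {j : S.X₃ ⟶ Q₀} {q : Q₀ ⟶ Q₁} [Mono i] [Mono j]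
    (hi : i ≫ p = 0) (hj : j ≫ q = 0) (hiex : (ShortComplex.mk i p hi).Exact)
    (hjex : (ShortComplex.mk j q hj).Exact) {t : Q₀ ⟶ P₁} {β : S.X₂ ⟶ P₀}
    (hβ : S.f ≫ β = i) (hβt : β ≫ p + S.g ≫ j ≫ t = 0) :
    ∃ w : biprod.lift β (S.g ≫ j) ≫ biprodUpper p t q = 0,
      (ShortComplex.mk _ _ w).Exact ∧ Mono (biprod.lift β (S.g ≫ j)) := by
  have := hS.mono_f
  have := hS.epi_g
  refine ⟨?_, ?_, ?_⟩
  · refine (biprod.lift_desc ..).trans (biprod.hom_ext _ _ ?_ ?_)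
    · simpa using hβt
    · simp [hj]
  · rw [ShortComplex.exact_iff_exact_up_to_refinements]
    intro A (x : A ⟶ P₀ ⊞ Q₀) (hx : x ≫ biprodUpper p t q = 0)
    obtain ⟨x, y, rfl⟩ : ∃ y z, x = biprod.lift y z :=
      ⟨x ≫ biprod.fst, x ≫ biprod.snd, biprod.hom_ext _ _ (by simp) (by simp)⟩
    replace hx := (biprod.lift_desc ..).symm.trans hx
    have hp : x ≫ p + y ≫ t = 0 := by
      simpa using congrArg (fun k => k ≫ biprod.fst) hx
    have hq : y ≫ q = 0 := by
      simpa using congrArg (fun k => k ≫ biprod.snd) hx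
    have hc : hjex.lift y hq ≫ j = y := hjex.lift_f y hq
    -- The cocycle `y` comes from `S.X₃`, hence after refinement from some `z` into `S.X₂`. The
    -- difference `π ≫ x - z ≫ β` is then a cocycle of `P`, so it comes from `S.X₁` and corrects `z`
    -- to the required preimage.
    obtain ⟨A', π, hπ, z, hz⟩ := surjective_up_to_refinements_of_epi S.g (hjex.lift y hq)
    have hp' : (π ≫ x - z ≫ β) ≫ p = 0 := by
      have e1 : β ≫ p = -(S.g ≫ j ≫ t) := eq_neg_of_add_eq_zero_left hβt
      rw [Preadditive.sub_comp, Category.assoc, Category.assoc, eq_neg_of_add_eq_zero_left hp, e1,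
        Preadditive.comp_neg, Preadditive.comp_neg, ← reassoc_of% hz, reassoc_of% hc, sub_self]
    have ha : hiex.lift _ hp' ≫ i = π ≫ x - z ≫ β := hiex.lift_f _ hp'
    refine ⟨A', π, hπ, z + hiex.lift _ hp' ≫ S.f, ?_⟩
    refine biprod.hom_ext _ _ ?_ ?_
    · simp [hβ, ha]
    · simp [← reassoc_of% hz, hc]
  · refine Preadditive.mono_of_cancel_zero _ fun {A} u hu => ?_
    have h1 : u ≫ β = 0 := by
      simpa using congrArg (fun k => k ≫ biprod.fst) hu
    have h2 : u ≫ S.g = 0 := by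
      rw [← cancel_mono j]
      simpa using congrArg (fun k => k ≫ biprod.snd) hu
    have h3 : hS.exact.lift u h2 ≫ S.f = u := hS.exact.lift_f u h2
    have h4 : hS.exact.lift u h2 = 0 := by
      rw [← cancel_mono i, zero_comp, ← hβ, ← h1, ← Category.assoc, h3]
    rw [← h3, h4, zero_comp]

end

section

variable {P Q : CochainComplex C ℕ} (θ : ∀ n, Q.X n ⟶ P.X (n + 1))
  (hθ : ∀ n, θ n ≫ P.d (n + 1) (n + 1 + 1) + Q.d n (n + 1) ≫ θ (n + 1) = 0)

/-- The extension of `Q` by `P` twisted by `θ`. -/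
def twistedSum : CochainComplex C ℕ where
  X n := P.X n ⊞ Q.X n
  d i j := if h : i + 1 = j then by
      subst h
      exact biprodUpper (P.d i (i + 1)) (θ i) (Q.d i (i + 1)) else 0
  shape i j h := dif_neg h
  d_comp_d' := by
    rintro i _ _ rfl rfl
    simp only [dif_pos]
    exact biprodUpper_comp (P.d_comp_d _ _ _) (Q.d_comp_d _ _ _) (hθ i)

theorem twistedSum_d (n : ℕ) : (twistedSum θ hθ).d n (n + 1) =
    biprodUpper (P.d n (n + 1)) (θ n) (Q.d n (n + 1)) :=
  dif_pos rfl

/-- The inclusion of `P` into the twisted sum. -/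
def twistedInl : P ⟶ twistedSum θ hθ where
  f n := (biprod.inl : P.X n ⟶ P.X n ⊞ Q.X n)
  comm' := by
    rintro i _ rfl
    exact (congrArg _ (twistedSum_d θ hθ i)).trans (inl_biprodUpper _ _ _)

/-- The projection of the twisted sum onto `Q`. -/
def twistedSnd : twistedSum θ hθ ⟶ Q where
  f n := (biprod.snd : P.X n ⊞ Q.X n ⟶ Q.X n)
  comm' := by
    rintro i _ rfl
    exact (biprodUpper_snd _ _ _).symm.trans
      (congrArg (fun k => k ≫ biprod.snd) (twistedSum_d θ hθ i).symm)

theorem twistedInl_comp_twistedSnd : twistedInl θ hθ ≫ twistedSnd θ hθ = 0 := by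
  ext n
  exact biprod.inl_snd

/-- The twisted sum splits in each degree. -/
def twistedSplitting (n : ℕ) :
    (ShortComplex.mk ((twistedInl θ hθ).f n) ((twistedSnd θ hθ).f n)
      (by rw [← HomologicalComplex.comp_f, twistedInl_comp_twistedSnd]; rfl)).Splitting :=
  ShortComplex.Splitting.ofHasBinaryBiproduct (P.X n) (Q.X n)

theorem twistedSum_shortExact :
    (ShortComplex.mk _ _ (twistedInl_comp_twistedSnd θ hθ)).ShortExact :=
  HomologicalComplex.shortExact_of_degreewise_shortExact _
    fun n => (twistedSplitting θ hθ n).shortExact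

end

/-- An exact coaugmented complex gives a quasi-isomorphism from a complex in degree `0`. -/
theorem exists_quasiIso_of_exact {B : C} (T : CochainComplex C ℕ)
    (b : B ⟶ T.X 0) (hb : b ≫ T.d 0 1 = 0) [Mono b]
    (hex : (ShortComplex.mk b (T.d 0 1) hb).Exact) (hT : ∀ n, T.ExactAt (n + 1)) :
    ∃ (φ : (CochainComplex.single₀ C).obj B ⟶ T) (_ : QuasiIso φ), φ.f 0 = b := by
  refine ⟨(CochainComplex.fromSingle₀Equiv _ _).symm ⟨b, hb⟩, ⟨fun n => ?_⟩, by simp⟩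
  cases n
  · rw [CochainComplex.quasiIsoAt₀_iff, ShortComplex.quasiIso_iff_of_zeros]
    · refine (ShortComplex.exact_and_mono_f_iff_of_iso ?_).2 ⟨hex, inferInstance⟩
      refine ShortComplex.isoMk (Iso.refl _) (Iso.refl _) (Iso.refl _) ?_ ?_
      · refine (Category.id_comp _).trans (Eq.trans ?_ (Category.comp_id _).symm)
        exact (CochainComplex.fromSingle₀Equiv_symm_apply_f_zero (C := T) b hb).symm
      · exact (Category.id_comp _).trans (Category.comp_id _).symm
    · rfl
    · rfl
    · exact T.shape 0 0 (by simp)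
  · rw [quasiIsoAt_iff_exactAt]
    · apply hT
    · apply CochainComplex.exactAt_succ_single_obj

/-- The twisting morphism and the augmentation from which a resolution of `S.X₂` is built out of
resolutions of `S.X₁` and `S.X₃`. -/
theorem exists_twist {S : ShortComplex C} (hS : S.ShortExact) (I : InjectiveResolution S.X₁)
    (J : InjectiveResolution S.X₃) :
    ∃ (θ : ∀ n, J.cocomplex.X n ⟶ I.cocomplex.X (n + 1)) (β : S.X₂ ⟶ I.cocomplex.X 0),
      (∀ n, θ n ≫ I.cocomplex.d (n + 1) (n + 1 + 1) + J.cocomplex.d n (n + 1) ≫ θ (n + 1) = 0) ∧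
      S.f ≫ β = I.ι.f 0 ∧ β ≫ I.cocomplex.d 0 1 + S.g ≫ J.ι.f 0 ≫ θ 0 = 0 := by
  have := hS.mono_f
  have := hS.epi_g
  let i : S.X₁ ⟶ I.cocomplex.X 0 := I.ι.f 0
  let j : S.X₃ ⟶ J.cocomplex.X 0 := J.ι.f 0
  have hi : i ≫ I.cocomplex.d 0 1 = 0 := I.ι_f_zero_comp_complex_d
  have hj : Mono j := inferInstanceAs (Mono (J.ι.f 0))
  let β : S.X₂ ⟶ I.cocomplex.X 0 := Injective.factorThru i S.f
  have hβ : S.f ≫ β = i := Injective.comp_factorThru _ _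
  have h1 : S.f ≫ (-(β ≫ I.cocomplex.d 0 1)) = 0 := by
    rw [Preadditive.comp_neg, ← Category.assoc, hβ, hi, neg_zero]
  -- The extension `β` of the augmentation need not be a cocycle. The defect vanishes on `S.X₁`, so
  -- it descends to `S.X₃`, and the twist is built by extending it over the resolution of `S.X₃`.
  let γ : S.X₃ ⟶ I.cocomplex.X 1 := hS.exact.desc _ h1
  have hγ : S.g ≫ γ = -(β ≫ I.cocomplex.d 0 1) := hS.exact.g_desc _ _
  have hγ0 : γ ≫ I.cocomplex.d 1 2 = 0 := by
    rw [← cancel_epi S.g, ← Category.assoc, hγ]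
    simp
  let t0 : J.cocomplex.X 0 ⟶ I.cocomplex.X 1 := Injective.factorThru γ j
  have ht0 : j ≫ t0 = γ := Injective.comp_factorThru _ _
  have : ∀ n, Injective ((truncShift I.cocomplex).X n) := fun n => I.injective (n + 1)
  have h2 : j ≫ t0 ≫ (truncShift I.cocomplex).d 0 1 = 0 := by
    change j ≫ t0 ≫ (-I.cocomplex.d 1 2) = 0
    rw [Preadditive.comp_neg, Preadditive.comp_neg, ← Category.assoc, ht0, hγ0, neg_zero]
  -- Comparison argument: `J` is exact and the target consists of injectives, so `t0` extends degree
  -- by degree. The start is `h2`.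
  let Θ : J.cocomplex ⟶ truncShift I.cocomplex :=
    CochainComplex.mkHom _ _ t0 (J.exact₀.descToInjective (t0 ≫ (truncShift I.cocomplex).d 0 1) h2)
    (J.exact₀.comp_descToInjective _ h2).symm fun n f =>
      ⟨(J.exact_succ n).descToInjective (f.2.1 ≫ (truncShift I.cocomplex).d (n + 1) (n + 2)) (by
        change J.cocomplex.d n (n + 1) ≫ f.2.1 ≫ _ = 0
        rw [← Category.assoc, ← f.2.2, Category.assoc, HomologicalComplex.d_comp_d, comp_zero]),
        ((J.exact_succ n).comp_descToInjective _ _).symm⟩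
  refine ⟨fun n => Θ.f n, β, fun n => ?_, hβ, ?_⟩
  · have h : -(Θ.f n ≫ I.cocomplex.d (n + 1) (n + 1 + 1)) = J.cocomplex.d n (n + 1) ≫ Θ.f (n + 1) :=
      (Preadditive.comp_neg _ _).symm.trans (Θ.comm n (n + 1))
    exact (congrArg _ h.symm).trans (add_neg_cancel _)
  · change _ + S.g ≫ j ≫ t0 = 0
    rw [ht0, hγ, add_neg_cancel]

variable [EnoughInjectives C]

/-- The horseshoe lemma. -/
theorem exists_injectiveResolution_shortExact {S : ShortComplex C} (hS : S.ShortExact) :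
    ∃ (I₁ : InjectiveResolution S.X₁) (I₂ : InjectiveResolution S.X₂)
      (I₃ : InjectiveResolution S.X₃) (φ : I₁.cocomplex ⟶ I₂.cocomplex)
      (ψ : I₂.cocomplex ⟶ I₃.cocomplex) (w : ∀ n, φ.f n ≫ ψ.f n = 0),
      I₁.ι.f 0 ≫ φ.f 0 = S.f ≫ I₂.ι.f 0 ∧ I₂.ι.f 0 ≫ ψ.f 0 = S.g ≫ I₃.ι.f 0 ∧
      ∀ n, Nonempty (ShortComplex.mk (φ.f n) (ψ.f n) (w n)).Splitting := by
  let I := injectiveResolution S.X₁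
  let J := injectiveResolution S.X₃
  obtain ⟨θ, β, hθ, hβ, hβθ⟩ := exists_twist hS I J
  let i : S.X₁ ⟶ I.cocomplex.X 0 := I.ι.f 0
  let j : S.X₃ ⟶ J.cocomplex.X 0 := J.ι.f 0
  have himono : Mono i := inferInstanceAs (Mono (I.ι.f 0))
  have hjmono : Mono j := inferInstanceAs (Mono (J.ι.f 0))
  obtain ⟨w, hex, hmono⟩ := exact_and_mono_lift_biprodUpper hS (i := i) (j := j)
    I.ι_f_zero_comp_complex_d J.ι_f_zero_comp_complex_d I.exact₀ J.exact₀ hβ hβθ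
  let b : S.X₂ ⟶ (twistedSum θ hθ).X 0 := biprod.lift β (S.g ≫ j)
  have hinj : ∀ n, Injective ((twistedSum θ hθ).X n) :=
    fun n => inferInstanceAs (Injective (I.cocomplex.X n ⊞ J.cocomplex.X n))
  have hbmono : Mono b := hmono
  obtain ⟨ι, hι, hι0⟩ := exists_quasiIso_of_exact (twistedSum θ hθ)
    -- In positive degrees, exactness of the twisted sum follows from that of its two ends.
    b (by rw [twistedSum_d]; exact w) (by simp only [twistedSum_d]; exact hex) fun n =>
      (twistedSum_shortExact θ hθ).exactAt_X₂ _ (I.cocomplex_exactAt_succ n)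
        (J.cocomplex_exactAt_succ n)
  refine ⟨I, ⟨twistedSum θ hθ, hinj, ι, hι⟩, J, twistedInl θ hθ, twistedSnd θ hθ,
    fun n => biprod.inl_snd, ?_, ?_, fun n => ⟨twistedSplitting θ hθ n⟩⟩
  · refine Eq.trans ?_ (congrArg (fun k => S.f ≫ k) hι0.symm)
    have h : i ≫ (biprod.inl : _ ⟶ _ ⊞ J.cocomplex.X 0) = S.f ≫ biprod.lift β (S.g ≫ j) := by
      refine biprod.hom_ext _ _ ?_ ?_
      · simpa using hβ.symm
      · simp
    exact h
  · refine (congrArg (fun k => k ≫ (twistedSnd θ hθ).f 0) hι0).trans ?_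
    exact biprod.lift_snd _ _

/-- The long exact sequence of right derived functors. -/
theorem exists_rightDerived_exact {D : Type*} [Category* D] [Abelian D] (F : C ⥤ D) [F.Additive]
    {S : ShortComplex C} (hS : S.ShortExact) (n : ℕ) :
    (∃ w₂ : (F.rightDerived n).map S.f ≫ (F.rightDerived n).map S.g = 0,
      (ShortComplex.mk _ _ w₂).Exact) ∧
    ∃ (δ : (F.rightDerived n).obj S.X₃ ⟶ (F.rightDerived (n + 1)).obj S.X₁)
      (w₁ : δ ≫ (F.rightDerived (n + 1)).map S.f = 0) (w₃ : (F.rightDerived n).map S.g ≫ δ = 0),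
      (ShortComplex.mk _ _ w₁).Exact ∧ (ShortComplex.mk _ _ w₃).Exact := by
  obtain ⟨I₁, I₂, I₃, φ, ψ, w, hφ, hψ, hspl⟩ := exists_injectiveResolution_shortExact hS
  let Φ := F.mapHomologicalComplex (ComplexShape.up ℕ)
  have w' : Φ.map φ ≫ Φ.map ψ = 0 := by
    rw [← Functor.map_comp, show φ ≫ ψ = 0 by ext n; exact w n, Functor.map_zero]
  -- Additive functors preserve split sequences, so degreewise splitting keeps the sequence of
  -- complexes short exact without any exactness of `F`.
  have hT : (ShortComplex.mk _ _ w').ShortExact :=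
    HomologicalComplex.shortExact_of_degreewise_shortExact _
      fun n => ((hspl n).some.map F).shortExact
  let e₁ (n : ℕ) : (F.rightDerived n).obj S.X₁ ≅ (Φ.obj I₁.cocomplex).homology n :=
    I₁.isoRightDerivedObj F n
  let e₂ (n : ℕ) : (F.rightDerived n).obj S.X₂ ≅ (Φ.obj I₂.cocomplex).homology n :=
    I₂.isoRightDerivedObj F n
  let e₃ (n : ℕ) : (F.rightDerived n).obj S.X₃ ≅ (Φ.obj I₃.cocomplex).homology n :=
    I₃.isoRightDerivedObj F n
  have nφ (n : ℕ) : (F.rightDerived n).map S.f ≫ (e₂ n).hom =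
      (e₁ n).hom ≫ HomologicalComplex.homologyMap (Φ.map φ) n :=
    InjectiveResolution.isoRightDerivedObj_hom_naturality S.f I₁ I₂ φ hφ F n
  have nψ (n : ℕ) : (F.rightDerived n).map S.g ≫ (e₃ n).hom =
      (e₂ n).hom ≫ HomologicalComplex.homologyMap (Φ.map ψ) n :=
    InjectiveResolution.isoRightDerivedObj_hom_naturality S.g I₂ I₃ ψ hψ F n
  have hn : (ComplexShape.up ℕ).Rel n (n + 1) := by simp
  let d : (Φ.obj I₃.cocomplex).homology n ⟶ (Φ.obj I₁.cocomplex).homology (n + 1) := hT.δ n (n + 1) hn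
  have hd₁ : d ≫ HomologicalComplex.homologyMap (Φ.map φ) (n + 1) = 0 := hT.δ_comp n (n + 1) hn
  have hd₃ : HomologicalComplex.homologyMap (Φ.map ψ) n ≫ d = 0 := hT.comp_δ n (n + 1) hn
  have h₂ : HomologicalComplex.homologyMap (Φ.map φ) n ≫
      HomologicalComplex.homologyMap (Φ.map ψ) n = 0 := by
    rw [← HomologicalComplex.homologyMap_comp, w', HomologicalComplex.homologyMap_zero]
  let δ : (F.rightDerived n).obj S.X₃ ⟶ (F.rightDerived (n + 1)).obj S.X₁ :=
    (e₃ n).hom ≫ d ≫ (e₁ (n + 1)).inv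
  have hδ : δ ≫ (e₁ (n + 1)).hom = (e₃ n).hom ≫ d := by
    simp only [δ, Category.assoc, Iso.inv_hom_id, Category.comp_id]
  refine ⟨⟨?_, ?_⟩, δ, ?_, ?_, ?_, ?_⟩
  · rw [← cancel_mono (e₃ n).hom, Category.assoc, nψ, reassoc_of% nφ, h₂, comp_zero, zero_comp]
  · refine (ShortComplex.exact_iff_of_iso ?_).2 (hT.homology_exact₂ n)
    exact ShortComplex.isoMk (e₁ n) (e₂ n) (e₃ n) (nφ n).symm (nψ n).symm
  · rw [← cancel_mono (e₂ (n + 1)).hom, Category.assoc, nφ, reassoc_of% hδ, hd₁, comp_zero,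
      zero_comp]
  · rw [← cancel_mono (e₁ (n + 1)).hom, Category.assoc, hδ, reassoc_of% nψ n, hd₃, comp_zero,
      zero_comp]
  · refine (ShortComplex.exact_iff_of_iso ?_).2 (hT.homology_exact₁ n (n + 1) hn)
    exact ShortComplex.isoMk (e₃ n) (e₁ (n + 1)) (e₂ (n + 1)) hδ.symm (nφ (n + 1)).symm
  · refine (ShortComplex.exact_iff_of_iso ?_).2 (hT.homology_exact₃ n (n + 1) hn)
    exact ShortComplex.isoMk (e₂ n) (e₃ n) (e₁ (n + 1)) (nψ n).symm hδ.symm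

end CategoryTheory
end Horseshoe

/-! ### Standard graded rings and removal of J₀ by Nakayama's lemma -/

namespace GrMod

section StandardGraded

variable {R : Type u} [CommRing R] (𝓡 : ℕ → AddSubgroup R) [GradedRing 𝓡]

theorem gradedProj_mem (k : ℕ) (r : R) : GradedRing.proj 𝓡 k r ∈ 𝓡 k := by
  rw [GradedRing.proj_apply]
  exact SetLike.coe_mem _

theorem gradedProj_of_mem {k : ℕ} {r : R} (hr : r ∈ 𝓡 k) : GradedRing.proj 𝓡 k r = r := by
  rw [GradedRing.proj_apply]
  exact DirectSum.decompose_of_mem_same 𝓡 hr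

theorem gradedProj_of_mem_ne {k l : ℕ} {r : R} (hr : r ∈ 𝓡 k) (h : k ≠ l) :
    GradedRing.proj 𝓡 l r = 0 := by
  rw [GradedRing.proj_apply]
  exact DirectSum.decompose_of_mem_ne 𝓡 hr h

theorem gradedProj_mul (k : ℕ) (a b : R) : GradedRing.proj 𝓡 k (a * b) =
    ∑ p ∈ Finset.HasAntidiagonal.antidiagonal k,
      GradedRing.proj 𝓡 p.1 a * GradedRing.proj 𝓡 p.2 b := by
  classical
  simp only [GradedRing.proj_apply, DirectSum.decompose_mul]
  exact DirectSum.coe_mul_apply_eq_sum_antidiagonal _ _ _ _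

theorem gradedProj_zero_mul {c : R} (hc : c ∈ 𝓡 0) (k : ℕ) (r : R) :
    GradedRing.proj 𝓡 k (c * r) = c * GradedRing.proj 𝓡 k r := by
  classical
  simp only [GradedRing.proj_apply]
  exact DirectSum.coe_decompose_mul_of_left_mem_zero 𝓡 hc

-- This makes the annihilator of a homogeneous element homogeneous: if `a • x = 0`, then each
-- component of `a` kills `x`.
variable {𝓡} in
theorem proj_smul_of_mem (M : GrMod 𝓡) {d : ℤ} {x : M.carrier} (hx : x ∈ M.deg d) (k : ℕ) (a : R) :
    M.proj (k + d) (a • x) = GradedRing.proj 𝓡 k a • x := by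
  induction a using DirectSum.Decomposition.inductionOn 𝓡 with
  | zero => simp
  | @homogeneous i a =>
    rw [M.proj_smul a.2]
    by_cases h : i = k
    · subst h
      rw [gradedProj_of_mem 𝓡 a.2, add_sub_cancel_left, M.proj_of_mem hx]
    · rw [gradedProj_of_mem_ne 𝓡 a.2 h, M.proj_of_mem_ne hx (by omega), smul_zero, zero_smul]
  | add a b ha hb => rw [add_smul, map_add, map_add, add_smul, ha, hb]

variable {𝓡} in
theorem proj_smul_of_mem_lt (M : GrMod 𝓡) {d n : ℤ} {x : M.carrier} (hx : x ∈ M.deg d) (h : n < d)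
    (a : R) : M.proj n (a • x) = 0 := by
  induction a using DirectSum.Decomposition.inductionOn 𝓡 with
  | zero => simp
  | homogeneous a => rw [M.proj_smul a.2, M.proj_of_mem_ne hx (by omega), smul_zero]
  | add a b ha hb => rw [add_smul, map_add, ha, hb, add_zero]

instance isNoetherianRing_zero [IsNoetherianRing R] : IsNoetherianRing (𝓡 0) :=
  isNoetherianRing_of_surjective R (𝓡 0) (GradedRing.projZeroRingHom' 𝓡)
    (GradedRing.projZeroRingHom'_surjective 𝓡)

/-- The homogeneous component `R_k` as an `R_0`-submodule of `R`. -/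
def degSubmodule (k : ℕ) : Submodule (𝓡 0) R where
  carrier := 𝓡 k
  add_mem' := add_mem
  zero_mem' := zero_mem _
  smul_mem' c r hr := by
    have := SetLike.GradedMul.mul_mem c.2 hr
    rwa [zero_add] at this

variable {𝓡} {s : Finset R} (hs : (s : Set R) ⊆ 𝓡 1)
  (hadj : Algebra.adjoin (𝓡 0) (s : Set R) = ⊤)

-- Induction over the algebra generated by `s` meets inhomogeneous elements, so the claim is proved
-- for all components of all elements at once. Products are handled by the convolution formula for
-- components.
include hs hadj in
theorem degSubmodule_le (k : ℕ) :
    degSubmodule 𝓡 k ≤ (Submodule.span (𝓡 0) (s : Set R)) ^ k := by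
  classical
  have key : ∀ r : R, ∀ k, GradedRing.proj 𝓡 k r ∈ (Submodule.span (𝓡 0) (s : Set R)) ^ k := by
    intro r
    have hr : r ∈ Algebra.adjoin (𝓡 0) (s : Set R) := by rw [hadj]; trivial
    induction hr using Algebra.adjoin_induction with
    | mem x hx =>
      intro k
      by_cases h : 1 = k
      · subst h
        rw [gradedProj_of_mem 𝓡 (hs hx), Submodule.pow_one]
        exact Submodule.subset_span hx
      · rw [gradedProj_of_mem_ne 𝓡 (hs hx) h]
        exact zero_mem _
    | algebraMap c =>
      intro k
      have hc : algebraMap (𝓡 0) R c ∈ 𝓡 0 := c.2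
      by_cases h : 0 = k
      · subst h
        rw [gradedProj_of_mem 𝓡 hc, Submodule.pow_zero]
        exact Submodule.algebraMap_mem c
      · rw [gradedProj_of_mem_ne 𝓡 hc h]
        exact zero_mem _
    | add x y _ _ hx hy =>
      intro k
      rw [map_add]
      exact add_mem (hx k) (hy k)
    | mul x y _ _ hx hy =>
      intro k
      rw [gradedProj_mul]
      refine sum_mem fun p hp => ?_
      rw [← Finset.HasAntidiagonal.mem_antidiagonal.1 hp]
      exact (pow_add (Submodule.span (𝓡 0) (s : Set R)) p.1 p.2).ge
        (Submodule.mul_mem_mul (hx _) (hy _))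
  intro r hr
  rw [← gradedProj_of_mem 𝓡 (show r ∈ 𝓡 k from hr)]
  exact key r k

include hs hadj in
theorem degSubmodule_fg [IsNoetherianRing R] (k : ℕ) : (degSubmodule 𝓡 k).FG := by
  have h : (Submodule.span (𝓡 0) (s : Set R) ^ k).FG :=
    Submodule.FG.pow (Submodule.fg_span s.finite_toSet) k
  exact h.of_le (degSubmodule_le hs hadj k)

-- Modulo the ideal generated by `s`, each element is congruent to its degree-zero part, because
-- this holds for generators and scalars and is stable under sums and products. It follows that `s`
-- generates R_+.
include hs hadj in
theorem sub_proj_zero_mem_span (r : R) :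
    r - GradedRing.proj 𝓡 0 r ∈ Ideal.span (s : Set R) := by
  have hr : r ∈ Algebra.adjoin (𝓡 0) (s : Set R) := by rw [hadj]; trivial
  induction hr using Algebra.adjoin_induction with
  | mem x hx =>
    rw [gradedProj_of_mem_ne 𝓡 (hs hx) one_ne_zero, sub_zero]
    exact Ideal.subset_span hx
  | algebraMap c =>
    have hc : algebraMap (𝓡 0) R c ∈ 𝓡 0 := c.2
    rw [gradedProj_of_mem 𝓡 hc, sub_self]
    exact zero_mem _
  | add x y _ _ hx hy =>
    rw [map_add, add_sub_add_comm]
    exact add_mem hx hy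
  | mul x y _ _ hx hy =>
    have h : GradedRing.proj 𝓡 0 (x * y) = GradedRing.proj 𝓡 0 x * GradedRing.proj 𝓡 0 y := by
      rw [gradedProj_mul, Finset.Nat.antidiagonal_zero, Finset.sum_singleton]
    rw [h, show x * y - GradedRing.proj 𝓡 0 x * GradedRing.proj 𝓡 0 y =
      (x - GradedRing.proj 𝓡 0 x) * y +
        GradedRing.proj 𝓡 0 x * (y - GradedRing.proj 𝓡 0 y) by ring]
    exact add_mem (Ideal.mul_mem_right _ _ hx) (Ideal.mul_mem_left _ _ hy)

include hs hadj in
theorem irrelevant_eq_span : (HomogeneousIdeal.irrelevant 𝓡).toIdeal = Ideal.span (s : Set R) := by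
  refine le_antisymm (fun r hr => ?_) (Ideal.span_le.2 fun r hr => ?_)
  · have := sub_proj_zero_mem_span hs hadj r
    rwa [(HomogeneousIdeal.mem_irrelevant_iff 𝓡 r).1 hr, sub_zero] at this
  · exact (HomogeneousIdeal.mem_irrelevant_iff 𝓡 r).2 (gradedProj_of_mem_ne 𝓡 (hs hr) one_ne_zero)

-- Since R_+ is generated in degree 1, its k-th power is generated in degree k. With
-- `le_irrelevant_pow`, this allows an inclusion R_+^k ⊆ Ann(x) to be tested on the single component
-- R_k, where Nakayama's lemma is available.
include hs hadj in
theorem irrelevant_pow_le_span (k : ℕ) :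
    (HomogeneousIdeal.irrelevant 𝓡).toIdeal ^ k ≤ Ideal.span (𝓡 k : Set R) := by
  induction k with
  | zero =>
    rw [pow_zero, Ideal.one_eq_top, top_le_iff, Ideal.eq_top_iff_one]
    exact Ideal.subset_span SetLike.GradedOne.one_mem
  | succ k ih =>
    have h1 : (HomogeneousIdeal.irrelevant 𝓡).toIdeal ≤ Ideal.span (𝓡 1 : Set R) := by
      rw [irrelevant_eq_span hs hadj]
      exact Ideal.span_mono hs
    rw [pow_succ]
    refine (Ideal.mul_mono ih h1).trans ?_
    rw [Ideal.span_mul_span']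
    refine Ideal.span_mono ?_
    rintro _ ⟨a, ha, b, hb, rfl⟩
    exact SetLike.GradedMul.mul_mem ha hb

include hs hadj in
theorem le_irrelevant_pow (k : ℕ) {r : R} (hr : r ∈ 𝓡 k) :
    r ∈ (HomogeneousIdeal.irrelevant 𝓡).toIdeal ^ k := by
  have key : (Submodule.span (𝓡 0) (s : Set R)) ^ k ≤
      ((HomogeneousIdeal.irrelevant 𝓡).toIdeal ^ k).restrictScalars (𝓡 0) := by
    clear hr
    induction k with
    | zero =>
      rw [Submodule.pow_zero, pow_zero, Ideal.one_eq_top]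
      exact fun _ _ => trivial
    | succ k ih =>
      rw [Submodule.pow_succ, pow_succ]
      refine Submodule.mul_le.2 fun a ha b hb => Ideal.mul_mem_mul (ih ha) ?_
      rw [irrelevant_eq_span hs hadj]
      exact Submodule.span_le_restrictScalars (𝓡 0) R (s : Set R) hb
  exact key (degSubmodule_le hs hadj k hr)

include hs hadj in
/-- Nakayama's lemma in degree `k` shows that `J_0 R` can be left out. -/
theorem irrelevant_pow_le_torsionOf [IsNoetherianRing R] [IsLocalRing (𝓡 0)] {J₀ : Ideal (𝓡 0)}
    (hJ₀ : J₀ ≤ IsLocalRing.maximalIdeal (𝓡 0)) (M : GrMod 𝓡) {d : ℤ} {x : M.carrier}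
    (hx : x ∈ M.deg d) {k : ℕ} (hk : (HomogeneousIdeal.irrelevant 𝓡).toIdeal ^ k ≤
      Ideal.torsionOf R M.carrier x ⊔ J₀.map (algebraMap (𝓡 0) R)) :
    (HomogeneousIdeal.irrelevant 𝓡).toIdeal ^ k ≤ Ideal.torsionOf R M.carrier x := by
  -- The degree-k part of J₀R lies in J₀R_k. The extra factor `r` makes the claim stable under
  -- multiplication by R in the span induction.
  have hJ : ∀ b ∈ J₀.map (algebraMap (𝓡 0) R), ∀ r,
      GradedRing.proj 𝓡 k (r * b) ∈ J₀ • degSubmodule 𝓡 k := by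
    intro b hb
    induction hb using Submodule.span_induction with
    | mem b hb =>
      obtain ⟨c, hc, rfl⟩ := hb
      intro r
      rw [mul_comm]
      refine (gradedProj_zero_mul 𝓡 c.2 k r).symm ▸ ?_
      exact Submodule.smul_mem_smul hc (gradedProj_mem 𝓡 k r : _ ∈ degSubmodule 𝓡 k)
    | zero => intro r; rw [mul_zero, map_zero]; exact zero_mem _
    | add a b _ _ ha hb => intro r; rw [mul_add, map_add]; exact add_mem (ha r) (hb r)
    | smul a b _ hb => intro r; rw [smul_eq_mul, ← mul_assoc]; exact hb _
  have hle : degSubmodule 𝓡 k ≤ (Ideal.torsionOf R M.carrier x).restrictScalars (𝓡 0) := by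
    refine Submodule.le_of_le_smul_of_le_jacobson_bot (degSubmodule_fg hs hadj k)
      (hJ₀.trans (IsLocalRing.maximalIdeal_le_jacobson _)) fun p hp => ?_
    obtain ⟨a, ha, b, hb, hab⟩ := Submodule.mem_sup.1 (hk (le_irrelevant_pow hs hadj k hp))
    -- Take degree-k components of p = a + b. The component of `a` still kills `x` because `x` is
    -- homogeneous, and that of `b` lies in J₀R_k.
    rw [← gradedProj_of_mem 𝓡 (show p ∈ 𝓡 k from hp), ← hab, map_add]
    refine Submodule.add_mem_sup ?_ (by simpa using hJ b hb 1)
    rw [Submodule.restrictScalars_mem, Ideal.mem_torsionOf_iff, ← M.proj_smul_of_mem hx,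
      (Ideal.mem_torsionOf_iff _ _).1 ha, map_zero]
  exact (irrelevant_pow_le_span hs hadj k).trans (Ideal.span_le.2 hle)

-- Pair torsion is homogeneous, so an element may be replaced by its components, to which the
-- Nakayama argument applies.
include hs hadj in
theorem pairTorsion_eq [IsNoetherianRing R] [IsLocalRing (𝓡 0)] {J₀ : Ideal (𝓡 0)}
    (hJ₀ : J₀ ≤ IsLocalRing.maximalIdeal (𝓡 0)) (M : GrMod 𝓡) :
    pairTorsion (HomogeneousIdeal.irrelevant 𝓡).toIdeal (J₀.map (algebraMap (𝓡 0) R)) M.carrier =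
      pairTorsion (HomogeneousIdeal.irrelevant 𝓡).toIdeal ⊥ M.carrier := by
  refine le_antisymm (fun x hx => ?_) ?_
  · obtain ⟨t, ht⟩ := M.exists_sum x
    rw [ht]
    refine sum_mem fun n _ => ?_
    obtain ⟨k, hk⟩ := mem_pairTorsion_iff.1 (M.proj_mem_pairTorsion _ _ hx n)
    exact mem_pairTorsion_iff.2 ⟨k, (irrelevant_pow_le_torsionOf hs hadj hJ₀ M
      (M.proj_mem n x) hk).trans le_sup_left⟩
  · rintro x ⟨n, hn⟩
    refine ⟨n, fun a ha => ?_⟩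
    obtain ⟨b, hb, h⟩ := hn a ha
    exact ⟨b, (bot_le : ⊥ ≤ J₀.map (algebraMap (𝓡 0) R)) hb, h⟩

end StandardGraded

end GrMod

/-! ### Exactness of graded modules in terms of elements -/

namespace GrMod

noncomputable section

section Exactness

variable {R : Type u} [CommRing R] {𝓡 : ℕ → AddSubgroup R}

/-- Exactness up to refinements is tested on the inclusion of the concrete kernel. The refining
epimorphism is surjective on elements, so it can be undone. -/
theorem exists_lin_eq_of_exact {S : ShortComplex (GrMod 𝓡)} (hS : S.Exact) {x : S.X₂.carrier}
    (hx : lin S.g x = 0) : ∃ y, lin S.f y = x := by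
  obtain ⟨A, π, hπ, z, hz⟩ := S.exact_iff_exact_up_to_refinements.1 hS (kerι S.g) (kerι_comp S.g)
  obtain ⟨a, ha⟩ := surjective_of_epi π ⟨x, hx⟩
  refine ⟨lin z a, ?_⟩
  have := congrArg (fun k => lin k a) hz
  exact this.symm.trans (congrArg (lin (kerι S.g)) ha)

theorem exists_lin_eq_of_exact_of_mem {S : ShortComplex (GrMod 𝓡)} (hS : S.Exact) {n : ℤ}
    {x : S.X₂.carrier} (hx : x ∈ S.X₂.deg n) (hgx : lin S.g x = 0) :
    ∃ y ∈ S.X₁.deg n, lin S.f y = x := by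
  obtain ⟨y, rfl⟩ := exists_lin_eq_of_exact hS hgx
  exact ⟨S.X₁.proj n y, S.X₁.proj_mem n y, by rw [lin_proj, S.X₂.proj_of_mem hx]⟩

theorem lin_comp_eq_zero {M N P : GrMod 𝓡} {f : M ⟶ N} {g : N ⟶ P} (h : f ≫ g = 0)
    (x : M.carrier) : lin g (lin f x) = 0 :=
  congrArg (fun k => lin k x) h

theorem epi_of_surjective {M N : GrMod 𝓡} (f : M ⟶ N) (h : Function.Surjective (lin f)) : Epi f :=
  ⟨fun _ _ hg => hom_ext fun x => by
    obtain ⟨y, rfl⟩ := h x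
    exact congrArg (fun k => lin k y) hg⟩

theorem isZero_of_forall_eq_zero {M : GrMod 𝓡} (h : ∀ x : M.carrier, x = 0) : IsZero M := by
  rw [IsZero.iff_id_eq_zero]
  exact hom_ext h

theorem eq_zero_of_isZero {M : GrMod 𝓡} (h : IsZero M) (x : M.carrier) : x = 0 :=
  congrArg (fun k => lin k x) ((IsZero.iff_id_eq_zero M).1 h)

theorem lin_iso_hom_inv {M N : GrMod 𝓡} (e : M ≅ N) (x : M.carrier) :
    lin e.inv (lin e.hom x) = x :=
  congrArg (fun k => lin k x) e.hom_inv_id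

end Exactness

/-! ### The torsion of an injective graded module is injective -/

section Torsion

variable {R : Type u} [CommRing R] {𝓡 : ℕ → AddSubgroup R}

/-- If `e` is such that all multiples of `e` in `T` are killed by powers of `I`, then some
`I ^ n e` meets `T` in zero only. -/
theorem exists_pow_inf_comap_le [IsNoetherianRing R] {Q : Type*} [AddCommGroup Q] [Module R Q] (I : Ideal R)
    (T : Submodule R Q) (hT : T ≤ pairTorsion I ⊥ Q) (e : Q) :
    ∃ n : ℕ, ∀ a ∈ I ^ n, a • e ∈ T → a • e = 0 := by
  let B : Ideal R := T.comap (LinearMap.toSpanSingleton R Q e)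
  obtain ⟨s, hs⟩ : B.FG := IsNoetherian.noetherian B
  have hk : ∀ b : R, ∃ k : ℕ, b ∈ B → ∀ a ∈ I ^ k, a • b • e = 0 := by
    intro b
    by_cases hb : b ∈ B
    · obtain ⟨k, hk⟩ := hT hb
      refine ⟨k, fun _ a ha => ?_⟩
      obtain ⟨c, hc, h⟩ := hk a ha
      rw [(Ideal.mem_bot).1 hc, zero_smul] at h
      exact h
    · exact ⟨0, fun h => absurd h hb⟩
  choose K hK using hk
  -- `B` consists of the multipliers that send `e` into `T`. It is finitely generated, so one power
  -- of `I` kills all of B e.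
  have hB : I ^ (s.sup K) * B ≤ Ideal.torsionOf R Q e := by
    rw [Ideal.mul_le]
    intro a ha b hb
    rw [Ideal.mem_torsionOf_iff, mul_smul]
    have hb' : b ∈ Ideal.span (s : Set R) := by rw [hs]; exact hb
    clear hb
    induction hb' using Submodule.span_induction with
    | mem b hbs =>
      exact hK b (hs ▸ Submodule.subset_span hbs) a (Ideal.pow_le_pow_right (Finset.le_sup hbs) ha)
    | zero => simp
    | add b c hb' hc' h1 h2 =>
      rw [add_smul, smul_add, h1, h2, add_zero]
    | smul r b hb' h1 => rw [smul_assoc, smul_comm, h1, smul_zero]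
  -- Artin–Rees: with m = `s.sup K`, I^(k+m) ∩ B = I^m (I^k ∩ B) ⊆ I^m B ⊆ Ann(e).
  obtain ⟨k, hk⟩ := Ideal.exists_pow_inf_eq_pow_smul I (N := B)
  refine ⟨k + s.sup K, fun a ha haT => ?_⟩
  have h1 : a ∈ I ^ (k + s.sup K) • (⊤ : Submodule R R) ⊓ B :=
    ⟨by simpa using ha, haT⟩
  rw [hk _ (Nat.le_add_right _ _), Nat.add_sub_cancel_left] at h1
  exact (Ideal.mem_torsionOf_iff _ _).1
    (hB (Submodule.smul_mono le_rfl inf_le_right h1))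

variable {I J : Ideal R}

theorem pairTorsion_map_le {Q Q' : Type*} [AddCommGroup Q] [Module R Q] [AddCommGroup Q']
    [Module R Q'] (f : Q →ₗ[R] Q') {x : Q} (hx : x ∈ pairTorsion I J Q) :
    f x ∈ pairTorsion I J Q' := by
  obtain ⟨n, hn⟩ := hx
  refine ⟨n, fun a ha => ?_⟩
  obtain ⟨b, hb, h⟩ := hn a ha
  exact ⟨b, hb, by rw [← map_smul, h, map_smul]⟩

/-- There is a homogeneous submodule maximal among those that do not meet the torsion. -/
theorem exists_maximal_disjoint (M : GrMod 𝓡) (T : Submodule R M.carrier) :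
    ∃ N : Submodule R M.carrier, (∀ x ∈ N, ∀ n, M.proj n x ∈ N) ∧ Disjoint N T ∧
      ∀ N' : Submodule R M.carrier, (∀ x ∈ N', ∀ n, M.proj n x ∈ N') → Disjoint N' T →
        N ≤ N' → N' ≤ N := by
  obtain ⟨N, -, hN⟩ := zorn_le_nonempty₀
    {N : Submodule R M.carrier | (∀ x ∈ N, ∀ n, M.proj n x ∈ N) ∧ Disjoint N T} (by
      intro c hc hchain y hy
      refine ⟨sSup c, ⟨fun x hx n => ?_, ?_⟩, fun z hz => le_sSup hz⟩
      · obtain ⟨P, hP, hxP⟩ := (Submodule.mem_sSup_of_directed ⟨y, hy⟩ hchain.directedOn).1 hx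
        exact le_sSup hP ((hc hP).1 x hxP n)
      · rw [Submodule.disjoint_def]
        intro x hx hxT
        obtain ⟨P, hP, hxP⟩ := (Submodule.mem_sSup_of_directed ⟨y, hy⟩ hchain.directedOn).1 hx
        exact Submodule.disjoint_def.1 (hc hP).2 x hxP hxT)
    ⊥ ⟨fun x hx n => by rw [(Submodule.mem_bot R).1 hx, map_zero]; exact zero_mem _, disjoint_bot_left⟩
  exact ⟨N, hN.prop.1, hN.prop.2, fun N' h1 h2 h3 => hN.le_of_ge ⟨h1, h2⟩ h3⟩

variable [IsNoetherianRing R] [GradedRing 𝓡]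

variable (I J) in
/-- The inclusion of the torsion submodule. -/
def gammaι (M : GrMod 𝓡) : (gamma 𝓡 I J).obj M ⟶ M :=
  mkHom (M := (gamma 𝓡 I J).obj M) (pairTorsion I J M.carrier).subtype fun _ _ h => h

instance (M : GrMod 𝓡) : Mono (gammaι I J M) := mono_of_injective _ Subtype.val_injective

/-- A morphism from a torsion module factors through the torsion submodule. -/
theorem exists_comp_gammaι_eq {M N : GrMod 𝓡} (hM : pairTorsion I J M.carrier = ⊤) (f : M ⟶ N) :
    ∃ g : M ⟶ (gamma 𝓡 I J).obj N, g ≫ gammaι I J N = f :=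
  ⟨mkHom (N := (gamma 𝓡 I J).obj N) ((lin f).codRestrict _ fun x => by
      obtain ⟨n, hn⟩ : x ∈ pairTorsion I J M.carrier := by rw [hM]; trivial
      refine ⟨n, fun a ha => ?_⟩
      obtain ⟨b, hb, h⟩ := hn a ha
      exact ⟨b, hb, by rw [← map_smul, h, map_smul]⟩) fun _ _ h => lin_deg f h, rfl⟩

-- Powers of a homogeneous ideal are homogeneous, so I^n m is a homogeneous submodule when m is a
-- homogeneous element. This is needed to test I^n m against maximality among homogeneous
-- submodules.
omit [IsNoetherianRing R] in
theorem map_span_singleton_homogeneous (hI : I.IsHomogeneous 𝓡) (n : ℕ) (M : GrMod 𝓡) {d : ℤ}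
    {m : M.carrier} (hm : m ∈ M.deg d) {a : R} (ha : a ∈ I ^ n) (i : ℤ) :
    ∃ b ∈ I ^ n, M.proj i (a • m) = b • m := by
  have hIn : (I ^ n).IsHomogeneous 𝓡 := by
    clear ha
    induction n with
    | zero => rw [pow_zero, Ideal.one_eq_top]; exact Ideal.IsHomogeneous.top 𝓡
    | succ n ih => rw [pow_succ]; exact ih.mul hI
  by_cases h : i < d
  · exact ⟨0, zero_mem _, by rw [M.proj_smul_of_mem_lt hm h, zero_smul]⟩
  · obtain ⟨k, hk⟩ := Int.eq_ofNat_of_zero_le (sub_nonneg.2 (not_lt.1 h))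
    obtain rfl : i = k + d := by omega
    exact ⟨_, by rw [GradedRing.proj_apply]; exact hIn k ha, M.proj_smul_of_mem hm k a⟩

/-- An essential extension of a torsion module is torsion. -/
theorem pairTorsion_quot_eq_top (hI : I.IsHomogeneous 𝓡) (M : GrMod 𝓡) {T N : Submodule R M.carrier}
    (hT : T ≤ pairTorsion I ⊥ M.carrier) (hN : ∀ x ∈ N, ∀ n, M.proj n x ∈ N) (hNT : Disjoint N T)
    (hmax : ∀ N' : Submodule R M.carrier, (∀ x ∈ N', ∀ n, M.proj n x ∈ N') → Disjoint N' T →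
        N ≤ N' → N' ≤ N) : pairTorsion I ⊥ (M.quot N hN).carrier = ⊤ := by
  refine eq_top_iff.2 fun q _ => ?_
  induction q using (M.quot N hN).hom_induction with
  | h0 => exact zero_mem _
  | hadd x y hx hy => exact add_mem (hx trivial) (hy trivial)
  | hdeg d q hq =>
    obtain ⟨m, hm, rfl⟩ := hq
    obtain ⟨n, hn⟩ := exists_pow_inf_comap_le I (T.map N.mkQ)
      (by rintro _ ⟨x, hx, rfl⟩; exact pairTorsion_map_le _ (hT hx)) (N.mkQ m)
    -- By the choice of `n`, enlarging `N` by I^n m still avoids `T`. Maximality gives I^n m ⊆ N, so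
    -- the class of `m` is torsion.
    let P : Submodule R M.carrier := N ⊔ Submodule.map (LinearMap.toSpanSingleton R M.carrier m) (I ^ n)
    have hPN : P ≤ N := by
      refine hmax P (fun x hx i => ?_) ?_ le_sup_left
      · obtain ⟨y, hy, _, ⟨a, ha, rfl⟩, rfl⟩ := Submodule.mem_sup.1 hx
        obtain ⟨b, hb, h⟩ := map_span_singleton_homogeneous hI n M hm ha i
        rw [map_add]
        exact Submodule.add_mem_sup (hN y hy i) ⟨b, hb, h.symm⟩
      · rw [Submodule.disjoint_def]
        intro x hx hxT
        obtain ⟨y, hy, _, ⟨a, ha, rfl⟩, rfl⟩ := Submodule.mem_sup.1 hx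
        have h1 : N.mkQ (y + a • m) = a • N.mkQ m := by
          rw [map_add, map_smul, show N.mkQ y = 0 from (Submodule.Quotient.mk_eq_zero N).2 hy,
            zero_add]
        have h2 : a • N.mkQ m = 0 := hn a ha ⟨_, hxT, h1⟩
        exact Submodule.disjoint_def.1 hNT _
          ((Submodule.Quotient.mk_eq_zero N).1 (h1.trans h2)) hxT
    refine ⟨n, fun a ha => ⟨0, zero_mem _, ?_⟩⟩
    refine Eq.trans ?_ (zero_smul R (A := (M.quot N hN).carrier) _).symm
    exact (Submodule.Quotient.mk_eq_zero N).2
      (hPN (Submodule.mem_sup_right ⟨a, ha, rfl⟩ : a • m ∈ P))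

/-- The torsion submodule of an injective graded module is injective. -/
theorem injective_gamma_obj (hI : I.IsHomogeneous 𝓡)
    (hJ : ∀ M : GrMod 𝓡, pairTorsion I J M.carrier = pairTorsion I ⊥ M.carrier)
    (M : GrMod 𝓡) [Injective M] : Injective ((gamma 𝓡 I J).obj M) := by
  obtain ⟨N, hN, hNT, hmax⟩ := exists_maximal_disjoint M (pairTorsion I J M.carrier)
  have hQ := pairTorsion_quot_eq_top hI M (hJ M).le hN hNT hmax
  rw [← hJ] at hQ
  let π : M ⟶ M.quot N hN := mkHom (N := M.quot N hN) N.mkQ fun _ x h => ⟨x, h, rfl⟩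
  have hmono : Mono (gammaι I J M ≫ π) := by
    refine mono_of_injective _ ((injective_iff_map_eq_zero _).2 fun x hx => Subtype.ext ?_)
    exact Submodule.disjoint_def.1 hNT _ ((Submodule.Quotient.mk_eq_zero N).1 hx) x.2
  -- The torsion embeds in M/N because it meets `N` trivially, and injectivity of `M` extends its
  -- inclusion to M/N. As M/N is torsion, the extension lands in the torsion of `M`, which is thus a
  -- retract of the injective `M`.
  let g : M.quot N hN ⟶ M := Injective.factorThru (gammaι I J M) (gammaι I J M ≫ π)
  have hg : (gammaι I J M ≫ π) ≫ g = gammaι I J M := Injective.comp_factorThru _ _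
  obtain ⟨r, hr⟩ := exists_comp_gammaι_eq hQ g
  have hretr : gammaι I J M ≫ (π ≫ r) = 𝟙 _ := by
    rw [← cancel_mono (gammaι I J M), Category.assoc, Category.assoc, hr, Category.id_comp,
      ← Category.assoc, hg]
  refine ⟨fun {X Y} u f _ => ⟨Injective.factorThru (u ≫ gammaι I J M) f ≫ (π ≫ r), ?_⟩⟩
  rw [← Category.assoc, Injective.comp_factorThru, Category.assoc, hretr, Category.comp_id]

end Torsion

end

end GrMod

/-! ### Left exactness of Γ and vanishing of higher cohomology on torsion modules -/

namespace GrMod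

noncomputable section

section

variable {R : Type u} [CommRing R] {𝓡 : ℕ → AddSubgroup R}

/-- The hypothesis says that the map from `S.X₁` to the concrete kernel is surjective, hence epi.
Exactness then transfers from the kernel sequence. -/
theorem exact_of_forall_exists {S : ShortComplex (GrMod 𝓡)}
    (h : ∀ x, lin S.g x = 0 → ∃ y, lin S.f y = x) : S.Exact := by
  let f : S.X₁ ⟶ kerObj S.g := mkHom (N := kerObj S.g)
    ((lin S.f).codRestrict (LinearMap.ker (lin S.g)) fun x => lin_comp_eq_zero S.zero x)
    fun _ _ hx => lin_deg S.f hx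
  have hf : Epi f := epi_of_surjective f fun x => by
    obtain ⟨y, hy⟩ := h x.1 x.2
    exact ⟨y, Subtype.ext hy⟩
  let α : S ⟶ ShortComplex.mk (kerι S.g) S.g (kerι_comp S.g) :=
    { τ₁ := f
      τ₂ := 𝟙 _
      τ₃ := 𝟙 _
      comm₁₂ := rfl
      comm₂₃ := rfl }
  have h1 : Epi α.τ₁ := hf
  have h2 : IsIso α.τ₂ := inferInstanceAs (IsIso (𝟙 _))
  have h3 : Mono α.τ₃ := inferInstanceAs (Mono (𝟙 _))
  exact (ShortComplex.exact_iff_of_epi_of_isIso_of_mono α).2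
    (ShortComplex.exact_of_f_is_kernel _ (kerIsLimit S.g))

theorem mem_pairTorsion_of_injective {I J : Ideal R} {Q Q' : Type*} [AddCommGroup Q] [Module R Q]
    [AddCommGroup Q'] [Module R Q'] (f : Q →ₗ[R] Q') (hf : Function.Injective f) {x : Q}
    (hx : f x ∈ pairTorsion I J Q') : x ∈ pairTorsion I J Q := by
  obtain ⟨n, hn⟩ := hx
  refine ⟨n, fun a ha => ?_⟩
  obtain ⟨b, hb, h⟩ := hn a ha
  exact ⟨b, hb, hf (by rw [map_smul, h, map_smul])⟩

theorem pairTorsion_eq_top_of_epi {I J : Ideal R} {M N : GrMod 𝓡} (f : M ⟶ N) [Epi f]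
    (hM : pairTorsion I J M.carrier = ⊤) : pairTorsion I J N.carrier = ⊤ := by
  refine eq_top_iff.2 fun x _ => ?_
  obtain ⟨y, rfl⟩ := surjective_of_epi f x
  exact pairTorsion_map_le _ (hM ▸ Submodule.mem_top)

theorem pairTorsion_eq_top_of_mono {I J : Ideal R} {M N : GrMod 𝓡} (f : M ⟶ N) [Mono f]
    (hN : pairTorsion I J N.carrier = ⊤) : pairTorsion I J M.carrier = ⊤ :=
  eq_top_iff.2 fun _ _ => mem_pairTorsion_of_injective _ (injective_of_mono f)
    (hN ▸ Submodule.mem_top)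

end

variable {R : Type u} [CommRing R] [IsNoetherianRing R] {𝓡 : ℕ → AddSubgroup R} [GradedRing 𝓡]
  {I J : Ideal R}

theorem pairTorsion_gamma_obj (M : GrMod 𝓡) :
    pairTorsion I J ((gamma 𝓡 I J).obj M).carrier = ⊤ :=
  eq_top_iff.2 fun x _ => mem_pairTorsion_of_injective (pairTorsion I J M.carrier).subtype
    Subtype.val_injective x.2

/-- Whether an element of a submodule is torsion does not depend on the ambient module, so Γ is left
exact. This identifies its zeroth derived functor with Γ itself. -/
instance : PreservesFiniteLimits (gamma 𝓡 I J) := by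
  rw [Functor.preservesFiniteLimits_iff_forall_exact_map_and_mono]
  intro S hS
  have := hS.mono_f
  have hf := injective_of_mono S.f
  refine ⟨exact_of_forall_exists fun x hx => ?_, mono_of_injective _ fun x y hxy => ?_⟩
  · obtain ⟨y, hy⟩ := exists_lin_eq_of_exact hS.exact (x := x.1) (congrArg Subtype.val hx)
    refine ⟨⟨y, mem_pairTorsion_of_injective (lin S.f) hf ?_⟩, Subtype.ext hy⟩
    rw [hy]
    exact x.2
  · exact Subtype.ext (hf (congrArg Subtype.val hxy))

/-- Local cohomology modules are torsion. -/
theorem pairTorsion_pairLocalCohomology (i : ℕ) (M : GrMod 𝓡) :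
    pairTorsion I J ((pairLocalCohomology 𝓡 I J i).obj M).carrier = ⊤ := by
  let E := injectiveResolution M
  let K := ((gamma 𝓡 I J).mapHomologicalComplex (ComplexShape.up ℕ)).obj E.cocomplex
  have h1 : pairTorsion I J (K.X i).carrier = ⊤ := pairTorsion_gamma_obj (E.cocomplex.X i)
  -- Cohomology is a subquotient of the torsion module Γ(E^i).
  have h2 : pairTorsion I J (K.homology i).carrier = ⊤ :=
    pairTorsion_eq_top_of_epi (K.homologyπ i) (pairTorsion_eq_top_of_mono (K.iCycles i) h1)
  let e : (pairLocalCohomology 𝓡 I J i).obj M ≅ K.homology i :=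
    E.isoRightDerivedObj (gamma 𝓡 I J) i
  exact pairTorsion_eq_top_of_mono e.hom h2

/-- Every preimage in a torsion module is torsion, so Γ keeps the map surjective. This kills the
connecting map in degree zero during dimension shifting. -/
theorem epi_map_zero_of_torsion {M N : GrMod 𝓡} (f : M ⟶ N) [Epi f]
    (hM : pairTorsion I J M.carrier = ⊤) : Epi (((gamma 𝓡 I J).rightDerived 0).map f) := by
  have h : Epi ((gamma 𝓡 I J).map f) := epi_of_surjective _ fun y => by
    obtain ⟨x, hx⟩ := surjective_of_epi f y.1
    exact ⟨⟨x, hM ▸ Submodule.mem_top⟩, Subtype.ext hx⟩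
  have h2 : Epi ((gamma 𝓡 I J).map f ≫ (gamma 𝓡 I J).toRightDerivedZero.app N) := epi_comp _ _
  rw [(gamma 𝓡 I J).toRightDerivedZero.naturality f] at h2
  exact epi_of_epi ((gamma 𝓡 I J).toRightDerivedZero.app M) _

/-- Higher local cohomology of torsion modules vanishes. -/
theorem isZero_pairLocalCohomology_succ (hI : I.IsHomogeneous 𝓡)
    (hJ : ∀ M : GrMod 𝓡, pairTorsion I J M.carrier = pairTorsion I ⊥ M.carrier) (i : ℕ)
    (M : GrMod 𝓡) (hM : pairTorsion I J M.carrier = ⊤) :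
    IsZero ((pairLocalCohomology 𝓡 I J (i + 1)).obj M) := by
  induction i using Nat.strong_induction_on generalizing M with | _ i ih
  obtain ⟨ι, hι⟩ := exists_comp_gammaι_eq hM (Injective.ι M)
  -- `M` embeds in the torsion part of an injective module, which is itself injective. The cokernel
  -- is again torsion, so dimension shifting stays among torsion modules.
  have := injective_gamma_obj hI hJ (Injective.under M)
  have hmono : Mono (ι ≫ gammaι I J (Injective.under M)) := hι ▸ inferInstance
  have hι' : Mono ι := mono_of_mono ι (gammaι I J (Injective.under M))
  have hS : (ShortComplex.mk ι (cokernel.π ι) (cokernel.condition ι)).ShortExact :=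
    { exact := ShortComplex.exact_cokernel ι }
  obtain ⟨-, δ, w₁, w₃, h₁, h₃⟩ := exists_rightDerived_exact (gamma 𝓡 I J) hS i
  have hE := (gamma 𝓡 I J).isZero_rightDerived_obj_injective_succ i
    ((gamma 𝓡 I J).obj (Injective.under M))
  -- The connecting map is epi because cohomology of the injective middle term vanishes. It is also
  -- zero: for `i = 0` by surjectivity on Γ, and for larger `i` because its source vanishes by
  -- induction.
  have hδ : Epi δ := h₁.epi_f (hE.eq_of_tgt _ _)
  have h0 : δ = 0 := by
    cases i with
    | zero =>
      have : Epi (((gamma 𝓡 I J).rightDerived 0).map (cokernel.π ι)) :=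
        epi_map_zero_of_torsion _ (pairTorsion_gamma_obj _)
      rw [← cancel_epi (((gamma 𝓡 I J).rightDerived 0).map (cokernel.π ι)), comp_zero]
      exact w₃
    | succ i =>
      exact (ih i i.lt_succ_self _ (pairTorsion_eq_top_of_epi (cokernel.π ι)
        (pairTorsion_gamma_obj _))).eq_of_src _ _
  have hzero := IsZero.of_epi_eq_zero δ h0
  exact hzero

end

end GrMod

/-! ### Degree shifts and multiplication by homogeneous elements -/

namespace GrMod

noncomputable section

section Shift

variable {R : Type u} [CommRing R] {𝓡 : ℕ → AddSubgroup R}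

/-- The graded module `M(a)`, with `M(a)_n = M_{n + a}`. -/
def twist (a : ℤ) (M : GrMod 𝓡) : GrMod 𝓡 where
  carrier := M.carrier
  deg n := M.deg (n + a)
  isInternal := by
    refine isInternal_of_proj _ (fun n => M.proj (n + a)) (fun n x hx => M.proj_of_mem hx)
      (fun m n x hx h => M.proj_of_mem_ne hx fun h' => h (by omega)) fun x => ?_
    induction x using M.hom_induction with
    | h0 => exact zero_mem _
    | hadd x y hx hy => exact add_mem hx hy
    | hdeg n x hx => exact AddSubgroup.mem_iSup_of_mem (n - a) (by rwa [sub_add_cancel])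
  smul_mem {i n r x} hr hx := by
    rw [add_assoc]
    exact M.smul_mem hr hx

variable (𝓡) in
/-- The functor `M ↦ M(a)`. -/
def twistFunctor (a : ℤ) : GrMod 𝓡 ⥤ GrMod 𝓡 where
  obj M := M.twist a
  map {M N} f := mkHom (M := M.twist a) (N := N.twist a) (lin (M := M) (N := N) f) fun _ _ h => lin_deg (M := M) (N := N) f h

instance (a : ℤ) : (twistFunctor 𝓡 a).Additive where
  map_add := rfl

/-- Twisting back gives the original module. -/
def twistTwistIso {a b : ℤ} (h : a + b = 0) (M : GrMod 𝓡) : (M.twist a).twist b ≅ M where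
  hom := mkHom (M := (M.twist a).twist b) LinearMap.id fun n x hx => by
    have hx' : x ∈ M.deg (n + b + a) := hx
    rwa [add_assoc, add_comm b, h, add_zero] at hx'
  inv := mkHom (N := (M.twist a).twist b) LinearMap.id fun n x hx => by
    change x ∈ M.deg (n + b + a)
    rwa [add_assoc, add_comm b, h, add_zero]
  hom_inv_id := rfl
  inv_hom_id := rfl

variable (𝓡) in
/-- Twisting is an equivalence. -/
def twistEquivalence (a : ℤ) : GrMod 𝓡 ≌ GrMod 𝓡 :=
  CategoryTheory.Equivalence.mk (twistFunctor 𝓡 a) (twistFunctor 𝓡 (-a))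
    (NatIso.ofComponents (fun M => (twistTwistIso (add_neg_cancel a) M).symm) fun _ => rfl)
    (NatIso.ofComponents (fun M => twistTwistIso (neg_add_cancel a) M) fun _ => rfl)

instance (a : ℤ) : (twistFunctor 𝓡 a).IsEquivalence :=
  (twistEquivalence 𝓡 a).isEquivalence_functor

/-- Multiplication by a homogeneous element, as a natural transformation. -/
def mulTwist {x : R} {a : ℕ} (hx : x ∈ 𝓡 a) : 𝟭 (GrMod 𝓡) ⟶ twistFunctor 𝓡 a where
  app M := mkHom (N := M.twist a) (LinearMap.lsmul R M.carrier x) fun n y hy => by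
    have := M.smul_mem hx hy
    rwa [add_comm] at this
  naturality {M N} f := hom_ext fun y => (map_smul (lin f) x y).symm

end Shift

variable {R : Type u} [CommRing R] [IsNoetherianRing R] {𝓡 : ℕ → AddSubgroup R} [GradedRing 𝓡]
  {I J : Ideal R}

omit [IsNoetherianRing R] [GradedRing 𝓡] in
theorem injective_twist (a : ℤ) (M : GrMod 𝓡) [Injective M] : Injective (M.twist a) :=
  (twistEquivalence 𝓡 a).symm.toAdjunction.map_injective M inferInstance

omit [IsNoetherianRing R] [GradedRing 𝓡] in
/-- Twisting an injective resolution. -/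
theorem exists_quasiIso_twist (a : ℤ) {M : GrMod 𝓡} (E : InjectiveResolution M) :
    ∃ (ι : (CochainComplex.single₀ _).obj (M.twist a) ⟶
        ((twistFunctor 𝓡 a).mapHomologicalComplex _).obj E.cocomplex) (_ : QuasiIso ι),
      ι.f 0 = (twistFunctor 𝓡 a).map (E.ι.f 0) := by
  let T := twistFunctor 𝓡 a
  let i : M ⟶ E.cocomplex.X 0 := E.ι.f 0
  have hi : i ≫ E.cocomplex.d 0 1 = 0 := E.ι_f_zero_comp_complex_d
  have himono : Mono i := inferInstanceAs (Mono (E.ι.f 0))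
  have hiex : (ShortComplex.mk i _ hi).Exact := E.exact₀
  let K := (T.mapHomologicalComplex (ComplexShape.up ℕ)).obj E.cocomplex
  let i' : T.obj M ⟶ K.X 0 := T.map i
  have himono' : Mono i' := inferInstanceAs (Mono (T.map i))
  have hi' : T.map i ≫ T.map (E.cocomplex.d 0 1) = 0 := by
    rw [← T.map_comp, hi, T.map_zero]
  have hK : ∀ n, K.ExactAt (n + 1) := fun n => by
    rw [HomologicalComplex.exactAt_iff' _ n (n + 1) (n + 2) (by simp) (by simp)]
    exact (E.exact_succ n).map T
  exact exists_quasiIso_of_exact K i' hi' (hiex.map T) hK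

/-- Multiplication by a homogeneous element on the module induces multiplication on local
cohomology. -/
theorem exists_iso_twist {x : R} {a : ℕ} (hx : x ∈ 𝓡 a) (i : ℕ) (M : GrMod 𝓡) :
    ∃ e : (pairLocalCohomology 𝓡 I J i).obj (M.twist a) ≅
        ((pairLocalCohomology 𝓡 I J i).obj M).twist a,
      ∀ y, lin e.hom (lin ((pairLocalCohomology 𝓡 I J i).map ((mulTwist hx).app M)) y) = x • y := by
  let F := gamma 𝓡 I J
  let T := twistFunctor 𝓡 a
  let E := injectiveResolution M
  obtain ⟨ι, hι, hι0⟩ := exists_quasiIso_twist (a : ℤ) E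
  let K := (F.mapHomologicalComplex (ComplexShape.up ℕ)).obj E.cocomplex
  let TE := (T.mapHomologicalComplex (ComplexShape.up ℕ)).obj E.cocomplex
  let E' : InjectiveResolution (M.twist a) :=
    ⟨TE, fun n => injective_twist a (E.cocomplex.X n), ι, hι⟩
  -- Multiplication by `x` on each term lifts multiplication on `M` to the resolutions, so it
  -- computes the induced map on cohomology.
  let φ : E.cocomplex ⟶ TE :=
    { f := fun n => (mulTwist hx).app (E.cocomplex.X n)
      comm' := fun m n _ => ((mulTwist hx).naturality (E.cocomplex.d m n)).symm }
  have hφ : E.ι.f 0 ≫ φ.f 0 = (mulTwist hx).app M ≫ E'.ι.f 0 :=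
    ((mulTwist hx).naturality (E.ι.f 0)).trans (congrArg _ hι0.symm)
  let S := K.sc i
  let S' := ((F.mapHomologicalComplex (ComplexShape.up ℕ)).obj TE).sc i
  let m : S.homology ⟶ S'.homology :=
    HomologicalComplex.homologyMap ((F.mapHomologicalComplex (ComplexShape.up ℕ)).map φ) i
  let e₁ : (pairLocalCohomology 𝓡 I J i).obj M ≅ S.homology := E.isoRightDerivedObj F i
  let e₂ : (pairLocalCohomology 𝓡 I J i).obj (T.obj M) ≅ S'.homology := E'.isoRightDerivedObj F i
  let μ : (pairLocalCohomology 𝓡 I J i).obj M ⟶ (pairLocalCohomology 𝓡 I J i).obj (T.obj M) :=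
    (pairLocalCohomology 𝓡 I J i).map ((mulTwist hx).app M)
  have h1 : μ ≫ e₂.hom = e₁.hom ≫ m :=
    InjectiveResolution.isoRightDerivedObj_hom_naturality ((mulTwist hx).app M) E E' φ hφ F i
  -- `e₃` and `e₅` have identity components: Γ commutes with the shift definitionally. They only put
  -- the complexes in the form in which `NatTrans.app_homology` says that multiplication by `x`
  -- commutes with homology.
  let e₃ : S.homology ≅ (S.map (𝟭 _)).homology := ShortComplex.homologyMapIso
    (ShortComplex.isoMk (Iso.refl _) (Iso.refl _) (Iso.refl _) rfl rfl)
  let e₄ : (S.map (𝟭 _)).homology ≅ S.homology := S.mapHomologyIso (𝟭 _)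
  let e₅ : S'.homology ≅ (S.map T).homology := ShortComplex.homologyMapIso
    (ShortComplex.isoMk (Iso.refl _) (Iso.refl _) (Iso.refl _) rfl rfl)
  let e₆ : (S.map T).homology ≅ T.obj S.homology := S.mapHomologyIso T
  let ν : S.homology ⟶ T.obj S.homology := (mulTwist hx).app S.homology
  let ρ : (S.map (𝟭 _)).homology ⟶ (S.map T).homology :=
    ShortComplex.homologyMap (S.mapNatTrans (mulTwist hx))
  have h2 : ν = e₄.inv ≫ ρ ≫ e₆.hom := NatTrans.app_homology (mulTwist hx) S
  have h3 : m ≫ e₅.hom = e₃.hom ≫ ρ := by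
    refine (ShortComplex.homologyMap_comp _ _).symm.trans
      (Eq.trans ?_ (ShortComplex.homologyMap_comp _ _))
    exact congrArg (fun k => ShortComplex.homologyMap k) (ShortComplex.hom_ext _ _ rfl rfl rfl)
  let α : (pairLocalCohomology 𝓡 I J i).obj M ≅ S.homology := e₁ ≪≫ e₃ ≪≫ e₄
  let β : (pairLocalCohomology 𝓡 I J i).obj (T.obj M) ≅ T.obj S.homology := e₂ ≪≫ e₅ ≪≫ e₆
  have h4 : μ ≫ β.hom = α.hom ≫ ν := by
    simp only [α, β, Iso.trans_hom, Category.assoc, h2, Iso.hom_inv_id_assoc]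
    rw [reassoc_of% h1, reassoc_of% h3]
  refine ⟨β ≪≫ (T.mapIso α).symm, fun y => ?_⟩
  have h5 := congrArg (fun k => lin (T.map α.inv) (lin k y)) h4
  refine Eq.trans h5 ?_
  change lin α.inv (x • lin α.hom y) = x • y
  rw [map_smul, lin_iso_hom_inv]

end

end GrMod

/-! ### Tame modules and Serre's finiteness theorem -/

namespace GrMod

noncomputable section

variable {R : Type u} [CommRing R] {𝓡 : ℕ → AddSubgroup R} [GradedRing 𝓡]

/-- The map induced on components of degree `n`. -/
def degMap {M N : GrMod 𝓡} (f : M ⟶ N) (n : ℤ) : M.deg n →ₗ[𝓡 0] N.deg n where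
  toFun x := ⟨lin f x, lin_deg f x.2⟩
  map_add' x y := Subtype.ext (map_add (lin f) (x : M.carrier) y)
  map_smul' r x := Subtype.ext (map_smul (lin f) (r : R) (x : M.carrier))

theorem finite_deg_of_exact [IsNoetherianRing R] {S : ShortComplex (GrMod 𝓡)} (hS : S.Exact) {n : ℤ}
    (h1 : Module.Finite (𝓡 0) (S.X₁.deg n)) (h3 : Module.Finite (𝓡 0) (S.X₃.deg n)) :
    Module.Finite (𝓡 0) (S.X₂.deg n) := by
  have h1' : IsNoetherian (𝓡 0) (S.X₁.deg n) := isNoetherian_of_isNoetherianRing_of_finite _ _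
  have h3' : IsNoetherian (𝓡 0) (S.X₃.deg n) := isNoetherian_of_isNoetherianRing_of_finite _ _
  have : IsNoetherian (𝓡 0) (S.X₂.deg n) := by
    refine isNoetherian_of_range_eq_ker (degMap S.f n) (degMap S.g n) (le_antisymm ?_ fun x hx => ?_)
    · rintro _ ⟨x, rfl⟩
      exact Subtype.ext (lin_comp_eq_zero S.zero (x : S.X₁.carrier))
    · obtain ⟨y, hy, h⟩ := exists_lin_eq_of_exact_of_mem hS x.2 (congrArg Subtype.val hx)
      exact ⟨⟨y, hy⟩, Subtype.ext h⟩
  infer_instance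

theorem finite_deg_of_mono [IsNoetherianRing R] {M N : GrMod 𝓡} (f : M ⟶ N) [Mono f] {n : ℤ}
    (h : Module.Finite (𝓡 0) (N.deg n)) : Module.Finite (𝓡 0) (M.deg n) :=
  Module.Finite.of_injective (degMap f n) fun _ _ hxy =>
    Subtype.ext (injective_of_mono f (congrArg Subtype.val hxy))

omit [GradedRing 𝓡] in
theorem deg_eq_bot_of_mono {M N : GrMod 𝓡} (f : M ⟶ N) [Mono f] {n : ℤ}
    (h : N.deg n = ⊥) : M.deg n = ⊥ := by
  refine (AddSubgroup.eq_bot_iff_forall _).2 fun x hx => injective_of_mono f ?_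
  rw [map_zero]
  exact (AddSubgroup.eq_bot_iff_forall _).1 h _ (lin_deg f hx)

/-- The components of `M` are finitely generated over `R_0`, and vanish in large degrees. -/
structure IsTame (M : GrMod 𝓡) : Prop where
  exists_deg_eq_bot : ∃ n₀ : ℤ, ∀ n ≥ n₀, M.deg n = ⊥
  finite_deg : ∀ n : ℤ, Module.Finite (𝓡 0) (M.deg n)

theorem IsTame.of_mono [IsNoetherianRing R] {M N : GrMod 𝓡} (hN : N.IsTame) (f : M ⟶ N) [Mono f] :
    M.IsTame where
  exists_deg_eq_bot := hN.exists_deg_eq_bot.imp fun _ h n hn => deg_eq_bot_of_mono f (h n hn)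
  finite_deg n := finite_deg_of_mono f (hN.finite_deg n)

theorem IsTame.of_isZero {M : GrMod 𝓡} (hM : IsZero M) : M.IsTame where
  exists_deg_eq_bot := ⟨0, fun _ _ =>
    (AddSubgroup.eq_bot_iff_forall _).2 fun x _ => eq_zero_of_isZero hM x⟩
  finite_deg n := by
    have : Subsingleton (M.deg n) := ⟨fun x y => Subtype.ext <|
      (eq_zero_of_isZero hM _).trans (eq_zero_of_isZero hM _).symm⟩
    infer_instance

/-- A finitely generated module that is killed by `R_+` is tame. -/
theorem IsTame.of_irrelevant_smul_eq_zero [IsNoetherianRing R] {M : GrMod 𝓡}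
    [Module.Finite R M.carrier]
    (hM : ∀ a ∈ (HomogeneousIdeal.irrelevant 𝓡).toIdeal, ∀ x : M.carrier, a • x = 0) :
    M.IsTame := by
  -- As R_+ acts by zero, R acts through its degree-zero component. Projections to the components of
  -- `M` therefore respect the action, and a degree bound for finitely many generators bounds `M`.
  have hsmul : ∀ (r : R) (x : M.carrier), r • x = GradedRing.proj 𝓡 0 r • x := by
    intro r x
    rw [← sub_eq_zero, ← sub_smul]
    refine hM _ ((HomogeneousIdeal.mem_irrelevant_iff 𝓡 _).2 ?_) x
    rw [map_sub, gradedProj_of_mem 𝓡 (gradedProj_mem 𝓡 0 r), sub_self]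
  constructor
  · have hB : ∀ x : M.carrier, ∃ B : ℤ, ∀ n ≥ B, M.proj n x = 0 := by
      intro x
      obtain ⟨t, ht⟩ := M.exists_sum x
      obtain ⟨B, hB⟩ := t.exists_le
      refine ⟨B + 1, fun n hn => ?_⟩
      rw [ht, map_sum]
      refine Finset.sum_eq_zero fun m hm => M.proj_of_mem_ne (M.proj_mem m x) ?_
      have := hB m hm
      omega
    choose B hB using hB
    obtain ⟨G, hG⟩ := Module.Finite.fg_top (R := R) (M := M.carrier)
    obtain ⟨n₀, hn₀⟩ := (G.image B).exists_le
    refine ⟨n₀, fun n hn => (AddSubgroup.eq_bot_iff_forall _).2 fun x hx => ?_⟩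
    have hxG : x ∈ Submodule.span R (G : Set M.carrier) := by rw [hG]; trivial
    rw [← M.proj_of_mem hx]
    clear hx
    induction hxG using Submodule.span_induction with
    | mem x hx => exact hB x n ((hn₀ _ (Finset.mem_image_of_mem B hx)).trans hn)
    | zero => exact map_zero _
    | add x y _ _ hx hy => rw [map_add, hx, hy, add_zero]
    | smul r x _ hx =>
      rw [hsmul, M.proj_smul (gradedProj_mem 𝓡 0 r), Nat.cast_zero, sub_zero, hx, smul_zero]
  · intro n
    -- Through R → R₀ the component becomes an R-submodule of the Noetherian module `M`. Finiteness
    -- over R then gives finiteness over R₀.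
    let : Algebra R (𝓡 0) := (GradedRing.projZeroRingHom' 𝓡).toAlgebra
    let : Module R (M.deg n) := Module.compHom (M.deg n) (GradedRing.projZeroRingHom' 𝓡)
    have : IsScalarTower R (𝓡 0) (M.deg n) :=
      ⟨fun r a x => mul_smul (GradedRing.projZeroRingHom' 𝓡 r) a x⟩
    let ι : M.deg n →ₗ[R] M.carrier :=
      { toFun := fun x => x
        map_add' := fun _ _ => rfl
        map_smul' := fun r x => (hsmul r x).symm }
    have : Module.Finite R (M.deg n) := Module.Finite.of_injective ι Subtype.val_injective
    exact Module.Finite.of_restrictScalars_finite R (𝓡 0) (M.deg n)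

section LocalCohomology

variable [IsNoetherianRing R] {I J : Ideal R}

instance {M N : GrMod 𝓡} (f : M ⟶ N) [Mono f] : Mono ((pairLocalCohomology 𝓡 I J 0).map f) := by
  have h : ((gamma 𝓡 I J).rightDerived 0).map f = inv ((gamma 𝓡 I J).toRightDerivedZero.app M) ≫
      (gamma 𝓡 I J).map f ≫ (gamma 𝓡 I J).toRightDerivedZero.app N :=
    (IsIso.eq_inv_comp _).2 ((gamma 𝓡 I J).toRightDerivedZero.naturality f).symm
  have : Mono (((gamma 𝓡 I J).rightDerived 0).map f) := by
    rw [h]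
    infer_instance
  exact this

theorem IsTame.pairLocalCohomology_zero {M : GrMod 𝓡} (hM : M.IsTame) :
    ((pairLocalCohomology 𝓡 I J 0).obj M).IsTame := by
  let e := inv ((gamma 𝓡 I J).toRightDerivedZero.app M)
  have : Mono (e ≫ gammaι I J M) := mono_comp _ _
  exact IsTame.of_mono (M := ((gamma 𝓡 I J).rightDerived 0).obj M) hM (e ≫ gammaι I J M)

/-- `Z` is the source of the connecting map, the previous cohomology of `S.X₃`. For `i = 0` it is
the kernel, which is zero by left exactness. Later arguments thus need no distinction of `i`. -/
theorem exists_isTame_exact {S : ShortComplex (GrMod 𝓡)} (hS : S.ShortExact)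
    (h : ∀ i, ((pairLocalCohomology 𝓡 I J i).obj S.X₃).IsTame) (i : ℕ) :
    ∃ (Z : GrMod 𝓡) (δ : Z ⟶ (pairLocalCohomology 𝓡 I J i).obj S.X₁)
      (w : δ ≫ (pairLocalCohomology 𝓡 I J i).map S.f = 0),
      Z.IsTame ∧ (ShortComplex.mk _ _ w).Exact := by
  cases i with
  | zero =>
    have := hS.mono_f
    exact ⟨_, kerι _, kerι_comp _, .of_isZero (isZero_of_forall_eq_zero fun x =>
      Subtype.ext (injective_of_mono ((pairLocalCohomology 𝓡 I J 0).map S.f)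
        (x.2.trans (map_zero _).symm))), ShortComplex.exact_of_f_is_kernel _ (kerIsLimit _)⟩
  | succ i =>
    obtain ⟨-, δ, w₁, -, h₁, -⟩ := exists_rightDerived_exact (gamma 𝓡 I J) hS i
    exact ⟨_, δ, w₁, h i, h₁⟩

/-- Tameness of local cohomology can be checked on the kernel and the cokernel of multiplication
by an element of degree `1`. -/
theorem isTame_of_kernel_of_cokernel {x : R} (hx : x ∈ 𝓡 1) (hxI : x ∈ I)
    (hJ : ∀ M : GrMod 𝓡, pairTorsion I J M.carrier = pairTorsion I ⊥ M.carrier) (M : GrMod 𝓡)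
    (hK : ∀ i, ((pairLocalCohomology 𝓡 I J i).obj (kernel ((mulTwist hx).app M))).IsTame)
    (hC : ∀ i, ((pairLocalCohomology 𝓡 I J i).obj
      (cokernel (Abelian.factorThruCoimage ((mulTwist hx).app M)))).IsTame) (i : ℕ) :
    ((pairLocalCohomology 𝓡 I J i).obj M).IsTame := by
  let H := pairLocalCohomology 𝓡 I J i
  let f := (mulTwist hx).app M
  -- Multiplication by `x` is split through its coimage, giving 0 → ker → M → coim → 0 and 0 → coim
  -- → M(1) → coker → 0.
  have hS₁ : (ShortComplex.mk (kernel.ι f) (Abelian.coimage.π f) (cokernel.condition _)).ShortExact :=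
    { exact := ShortComplex.exact_cokernel (kernel.ι f) }
  have hS₂ : (ShortComplex.mk (Abelian.factorThruCoimage f)
      (cokernel.π (Abelian.factorThruCoimage f)) (cokernel.condition _)).ShortExact :=
    { exact := ShortComplex.exact_cokernel _ }
  obtain ⟨⟨w₁, ex₁⟩, -⟩ := exists_rightDerived_exact (gamma 𝓡 I J) hS₁ i
  obtain ⟨Z, δ, w₂, hZ, ex₂⟩ := exists_isTame_exact hS₂ hC i
  obtain ⟨e, he⟩ := exists_iso_twist (I := I) (J := J) hx i M
  have hfac : H.map (Abelian.coimage.π f) ≫ H.map (Abelian.factorThruCoimage f) = H.map f := by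
    rw [← H.map_comp, Abelian.coimage.fac]
  -- Where the cohomology of the kernel and `Z` both vanish, the two exact sequences make
  -- multiplication by `x` on H^i(M) injective.
  have hinj : ∀ n, (H.obj (kernel f)).deg n = ⊥ → Z.deg n = ⊥ → ∀ y ∈ (H.obj M).deg n,
      x • y = 0 → y = 0 := by
    intro n hKn hZn y hy hxy
    have h1 : lin (H.map f) y = 0 :=
      injective_of_mono e.hom (((he y).trans hxy).trans (map_zero (lin e.hom)).symm)
    have h2 : lin (H.map (Abelian.factorThruCoimage f)) (lin (H.map (Abelian.coimage.π f)) y) = 0 :=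
      (congrArg (fun k => lin k y) hfac).trans h1
    obtain ⟨z, hz, hz'⟩ := exists_lin_eq_of_exact_of_mem ex₂
      (lin_deg (H.map (Abelian.coimage.π f)) hy) h2
    have hz0 : z = 0 := (AddSubgroup.eq_bot_iff_forall _).1 hZn z hz
    obtain ⟨k, hk, hk'⟩ := exists_lin_eq_of_exact_of_mem ex₁ hy
      (hz'.symm.trans ((congrArg (lin δ) hz0).trans (map_zero (lin δ))))
    have hk0 : k = 0 := (AddSubgroup.eq_bot_iff_forall _).1 hKn k hk
    exact hk'.symm.trans ((congrArg (lin (H.map (kernel.ι f))) hk0).trans (map_zero _))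
  obtain ⟨n₁, hn₁⟩ := (hK i).exists_deg_eq_bot
  obtain ⟨n₂, hn₂⟩ := hZ.exists_deg_eq_bot
  have hbot : ∀ n ≥ max n₁ n₂, (H.obj M).deg n = ⊥ := by
    -- Multiplying by `x` raises the degree by one and so stays in the range of injectivity. Hence
    -- powers of `x` are injective there too.
    have key : ∀ t : ℕ, ∀ n ≥ max n₁ n₂, ∀ y ∈ (H.obj M).deg n, x ^ t • y = 0 → y = 0 := by
      intro t
      induction t with
      | zero =>
        intro n _ y _ h
        rwa [pow_zero, one_smul] at h
      | succ t ih =>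
        intro n hn y hy h
        refine hinj n (hn₁ n (by omega)) (hn₂ n (by omega)) y hy ?_
        refine ih _ (by omega) _ ((H.obj M).smul_mem hx hy) ?_
        rwa [← mul_smul, ← pow_succ]
    intro n hn
    refine (AddSubgroup.eq_bot_iff_forall _).2 fun y hy => ?_
    have hy' : y ∈ pairTorsion I ⊥ (H.obj M).carrier := by
      rw [← hJ, pairTorsion_pairLocalCohomology]
      trivial
    obtain ⟨t, ht⟩ := hy'
    obtain ⟨b, hb, hxy⟩ := ht _ (Ideal.pow_mem_pow hxI t)
    rw [(Ideal.mem_bot).1 hb, zero_smul] at hxy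
    exact key t n hn y hy hxy
  -- H^i(M)_n lies between the cohomology of the kernel and that of the coimage. The latter is
  -- controlled by Z_n and H^i(M(1))_n ≅ H^i(M)_{n+1}.
  have hstep : ∀ n, Module.Finite (𝓡 0) ((H.obj M).deg (n + 1)) →
      Module.Finite (𝓡 0) ((H.obj M).deg n) := by
    intro n hn
    have h1 : Module.Finite (𝓡 0) ((H.obj (M.twist (1 : ℕ))).deg n) :=
      finite_deg_of_mono e.hom (n := n) hn
    exact finite_deg_of_exact ex₁ ((hK i).finite_deg n)
      (finite_deg_of_exact ex₂ (hZ.finite_deg n) h1)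
  refine ⟨⟨_, hbot⟩, fun n => ?_⟩
  have hfin : ∀ n ≥ max n₁ n₂, Module.Finite (𝓡 0) ((H.obj M).deg n) := fun n hn => by
    have : Subsingleton ((H.obj M).deg n) := by
      rw [hbot n hn]
      infer_instance
    infer_instance
  have hdesc : ∀ (d : ℕ) (n : ℤ), max n₁ n₂ ≤ n + d → Module.Finite (𝓡 0) ((H.obj M).deg n) := by
    intro d
    induction d with
    | zero => exact fun n hn => hfin n (by simpa using hn)
    | succ d ih => exact fun n hn => hstep n (ih _ (by push_cast at hn; omega))
  exact hdesc (max n₁ n₂ - n).toNat n (by omega)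

variable {s : Finset R} (hs : (s : Set R) ⊆ 𝓡 1)
  (hadj : Algebra.adjoin (𝓡 0) (s : Set R) = ⊤)

include hs hadj in
/-- Local cohomology of finitely generated graded modules with support in `R_+` is tame. -/
theorem isTame_pairLocalCohomology
    (hJ : ∀ M : GrMod 𝓡, pairTorsion (HomogeneousIdeal.irrelevant 𝓡).toIdeal J M.carrier =
      pairTorsion (HomogeneousIdeal.irrelevant 𝓡).toIdeal ⊥ M.carrier) (M : GrMod 𝓡)
    (hM : Module.Finite R M.carrier) (i : ℕ) :
    ((pairLocalCohomology 𝓡 (HomogeneousIdeal.irrelevant 𝓡).toIdeal J i).obj M).IsTame := by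
  classical
  -- Induction on the set `t` of generators that are allowed to act nontrivially on `M`. For `t`
  -- empty, R_+ kills `M`; for `t = s` there is no condition.
  have key : ∀ t : Finset R, t ⊆ s → ∀ M : GrMod 𝓡, Module.Finite R M.carrier →
      (∀ y ∈ s, y ∉ t → ∀ m : M.carrier, y • m = 0) → ∀ i,
      ((pairLocalCohomology 𝓡 (HomogeneousIdeal.irrelevant 𝓡).toIdeal J i).obj M).IsTame := by
    intro t
    induction t using Finset.induction_on with
    | empty =>
      intro _ M hM hsM i
      have hann : ∀ a ∈ (HomogeneousIdeal.irrelevant 𝓡).toIdeal, ∀ x : M.carrier, a • x = 0 := by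
        intro a ha x
        rw [irrelevant_eq_span hs hadj] at ha
        exact (Ideal.mem_torsionOf_iff x a).1 (Ideal.span_le.2
          (fun y hy => (Ideal.mem_torsionOf_iff x y).2 (hsM y hy (Finset.notMem_empty y) x)) ha)
      cases i with
      | zero => exact (IsTame.of_irrelevant_smul_eq_zero hann).pairLocalCohomology_zero
      | succ i =>
        refine .of_isZero (isZero_pairLocalCohomology_succ
          (HomogeneousIdeal.irrelevant 𝓡).isHomogeneous hJ i M (eq_top_iff.2 fun x _ => ?_))
        exact ⟨1, fun a ha => ⟨0, zero_mem _, by rw [hann a (pow_one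
          (HomogeneousIdeal.irrelevant 𝓡).toIdeal ▸ ha), zero_smul]⟩⟩
    | insert x t hxt ih =>
      intro hts M hM hsM i
      have hxs : x ∈ s := hts (Finset.mem_insert_self x t)
      have hx : x ∈ 𝓡 1 := hs hxs
      have hxI : x ∈ (HomogeneousIdeal.irrelevant 𝓡).toIdeal := by
        rw [irrelevant_eq_span hs hadj]
        exact Ideal.subset_span hxs
      have ih' := ih ((Finset.subset_insert x t).trans hts)
      let f : M ⟶ M.twist (1 : ℕ) := (mulTwist hx).app M
      let g := Abelian.factorThruCoimage f
      -- The kernel and cokernel of multiplication by `x` are killed by `x` and by every generator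
      -- that kills `M`, so `x` leaves the set of exceptions.
      have hK : ∀ y ∈ s, y ∉ t → ∀ m : (kernel f).carrier, y • m = 0 := by
        intro y hys hyt m
        refine injective_of_mono (kernel.ι f) ?_
        rw [map_smul, map_zero]
        by_cases hyx : y = x
        · subst hyx
          exact lin_comp_eq_zero (kernel.condition f) m
        · exact hsM y hys (by simp [hyx, hyt]) _
      have hC : ∀ y ∈ s, y ∉ t → ∀ c : (cokernel g).carrier, y • c = 0 := by
        intro y hys hyt c
        obtain ⟨m, rfl⟩ := surjective_of_epi (cokernel.π g) c
        rw [← map_smul]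
        by_cases hyx : y = x
        · subst hyx
          have h1 : lin g (lin (Abelian.coimage.π f) m) = y • m :=
            congrArg (fun k : M ⟶ M.twist (1 : ℕ) => lin k m) (Abelian.coimage.fac f)
          rw [← h1]
          exact lin_comp_eq_zero (cokernel.condition g) _
        · rw [show y • m = 0 from hsM y hys (by simp [hyx, hyt]) m, map_zero]
      have : Module.Finite R (M.twist (1 : ℕ)).carrier := hM
      exact isTame_of_kernel_of_cokernel hx hxI hJ M
        (ih' _ (Module.Finite.of_injective _ (injective_of_mono (kernel.ι f))) hK)
        (ih' _ (Module.Finite.of_surjective _ (surjective_of_epi (cokernel.π g))) hC) i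
  exact key s subset_rfl M hM (fun y hy hy' => absurd hy hy') i

end LocalCohomology

end

end GrMod

theorem theorem3p3 {R : Type u} [CommRing R] [IsNoetherianRing R]
    (𝓡 : ℕ → AddSubgroup R) [GradedRing 𝓡]
    (hgen : ∃ s : Finset R, (s : Set R) ⊆ 𝓡 1 ∧ Algebra.adjoin (𝓡 0) (s : Set R) = ⊤)
    [IsLocalRing (𝓡 0)] (J₀ : Ideal (𝓡 0)) (hJ₀ : J₀ ≤ IsLocalRing.maximalIdeal (𝓡 0)) :
    (∀ M : GrMod 𝓡, Module.Finite R M.carrier → ∀ i : ℕ, ∃ n₀ : ℤ, ∀ n ≥ n₀,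
      ((GrMod.pairLocalCohomology 𝓡 (HomogeneousIdeal.irrelevant 𝓡).toIdeal
        (J₀.map (algebraMap (𝓡 0) R)) i).obj M).deg n = ⊥) ↔
    (∀ M : GrMod 𝓡, Module.Finite R M.carrier → ∀ (i : ℕ) (n : ℤ),
      Module.Finite (𝓡 0)
        (((GrMod.pairLocalCohomology 𝓡 (HomogeneousIdeal.irrelevant 𝓡).toIdeal
          (J₀.map (algebraMap (𝓡 0) R)) i).obj M).deg n)) := by
  obtain ⟨s, hs, hadj⟩ := hgen
  have h := GrMod.isTame_pairLocalCohomology hs hadj (GrMod.pairTorsion_eq hs hadj hJ₀)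
  exact ⟨fun _ M hM i n => (h M hM i).finite_deg n, fun _ M hM i => (h M hM i).exists_deg_eq_bot⟩
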